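/- Let $K$ be a field. A directed graph $E=(E^0,E^1,s,r)$ is finite if $E^0$ and $E^1$ are finite, connected if any two vertices are joined by a (possibly empty) walk in which edges may be read in either direction, and the out-degree of a vertex $v$ is $|s^{-1}(v)|$; a vertex of out-degree $0$ is a sink. A path $p=e_1\cdots e_n$ satisfies $r(e_i)=s(e_{i+1})$, has length $|p|=n$, and a vertex is a path of length $0$. A cycle is a path $e_1\cdots e_n$, $n\ge 1$, with $r(e_n)=s(e_1)$ and pairwise distinct $s(e_i)$; in addition, each sink is regarded as a (trivial) cycle of length $0$. Put $s(v)=r(v)=v$ for $v\in E^0$, and $s(e^*)=r(e)$, $r(e^*)=s(e)$ for $e\in E^1$. The Leavitt inverse semigroup $LI(E)$ is the semigroup with zero generated by $E^0\cup E^1\cup (E^1)^*$ subject to (i) $s(a)a=a\,r(a)=a$ for all generators $a$; (ii) $uv=0$ for distinct $u,v\in E^0$; (iii) $e^*f=0$ for distinct $e,f\in E^1$; (iv) $e^*e=r(e)$ for $e\in E^1$; (v) $v=ee^*$ for each $v\in E^0$ of out-degree $1$ and $e\in s^{-1}(v)$. The Leavitt path algebra $L_K(E)$ is the associative $K$-algebra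 generated by the same elements (with unit $\sum_{v\in E^0}v$) subject to (i)--(iv) and $v=\sum_{e\in s^{-1}(v)}ee^*$ for each $v\in E^0$ that is not a sink. Both are $\mathbb Z$-graded: for paths $p,q$ with $r(p)=r(q)$ the element $pq^*$ has degree $|p|-|q|$ (so the component of degree $n$ consists of $0$ and the $pq^*$ of degree $n$, respectively is the $K$-span of the $pq^*$ of degree $n$). Write $\cong_{gr}$ for the existence of an isomorphism (of semigroups, respectively of $K$-algebras) that maps each homogeneous component into the component of the same degree. For a cycle $C$ of a finite connected graph $E$ whose vertices have out-degree at most $1$, and a vertex $v_0$ on $C$, the relative depth of a vertex $v$ with respect to $v_0$ is $|p| \bmod |C|$, where $p$ is the unique path from $v$ to $v_0$ in the graph obtained from $E$ by removing the edge (if any) that starts at $v_0$, and where $m \bmod 0 = m$. Theorem. Let $E$ and $F$ be connected finite graphs whose vertices have out-degree at most $1$, and let $C_1$ and $C_2$ be (possibly trivial) cycles of $E$ and $F$ respectively. The following are equivalent: (1) $L_K(E)\cong_{gr} L_K(F)$ as $\mathbb Z$-graded algebras; (2) $LI(E)\cong_{gr} LI(F)$ as $\mathbb Z$-graded semigroups;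 (3) $|C_1|=|C_2|$, and there are vertices $v_0$ on $C_1$ and $w_0$ on $C_2$ such that for every integer $d\ge 0$ the number of vertices of $E$ of relative depth $d$ with respect to $v_0$ equals the number of vertices of $F$ of relative depth $d$ with respect to $w_0$. -/

import Mathlib

universe u v w

/-- A directed graph `E = (E⁰, E¹, s, r)` with vertex set `V` and edge set `A`
(loops and parallel edges are allowed). -/
structure DirectedGraph (V : Type u) (A : Type v) where
  /-- the source map `s : E¹ → E⁰` -/
  src : A → V
  /-- the range map `r : E¹ → E⁰` -/
  rng : A → V

namespace DirectedGraph

/-- The generators `E⁰ ∪ E¹ ∪ (E¹)^*`. -/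
inductive Gen (V : Type u) (A : Type v) : Type (max u v) where
  | vert : V → Gen V A
  | edge : A → Gen V A
  | ghost : A → Gen V A

variable {V : Type u} {A : Type v}

/-- The out-degree `|s⁻¹(v)|` of a vertex. -/
noncomputable def outDegree (E : DirectedGraph V A) (x : V) : ℕ∞ :=
  {e : A | E.src e = x}.encard

/-- A sink is a vertex of out-degree `0`. -/
def IsSink (E : DirectedGraph V A) (x : V) : Prop :=
  E.outDegree x = 0

/-- `E` is connected: any two vertices are joined by a (possibly empty) walk, that is, a sequence of
edges, each of them read in either direction. -/
def Connected (E : DirectedGraph V A) : Prop :=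
  ∀ x y : V, Relation.ReflTransGen
    (fun a b => ∃ e : A, (E.src e = a ∧ E.rng e = b) ∨ (E.rng e = a ∧ E.src e = b)) x y

/-- `E.IsPath x p y`: the list of edges `p = e₁ e₂ ⋯ eₙ` is a path with source `x` and range `y`.
The empty list is the path of length `0` at a vertex. The length of the path is `p.length`. -/
def IsPath (E : DirectedGraph V A) : V → List A → V → Prop
  | x, [], y => x = y
  | x, e :: p, y => E.src e = x ∧ IsPath E (E.rng e) p y

/-- A possibly trivial cycle of `E`: a path `e₁ ⋯ eₙ` with equal source and range (the vertex `base`)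
and pairwise distinct `s(eᵢ)`. Cycles of length `0` are allowed only at sinks. -/
structure Cyc (E : DirectedGraph V A) where
  base : V
  edges : List A
  isPath : E.IsPath base edges base
  nodup : (edges.map E.src).Nodup
  sink_of_nil : edges = [] → E.IsSink base

/-- The length `|C|` of a cycle. -/
def Cyc.length {E : DirectedGraph V A} (C : E.Cyc) : ℕ :=
  C.edges.length

/-- The vertex `x` lies on the cycle `C`. -/
def Cyc.IsOn {E : DirectedGraph V A} (C : E.Cyc) (x : V) : Prop :=
  x = C.base ∨ x ∈ C.edges.map E.src

/-- `x` has relative depth `d` with respect to the vertex `x₀` of the cycle `C`: there is a path from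
`x` to `x₀` that avoids the edges starting at `x₀`, and its length is `d` modulo `|C|`. Here
`m % 0 = m`, so for a sink `x₀` the relative depth is the length of the path. -/
def Cyc.HasRelDepth {E : DirectedGraph V A} (C : E.Cyc) (x₀ x : V) (d : ℕ) : Prop :=
  ∃ p : List A, E.IsPath x p x₀ ∧ (∀ e ∈ p, E.src e ≠ x₀) ∧ p.length % C.length = d

/-- The number of vertices of relative depth `d` with respect to `x₀`. -/
noncomputable def Cyc.numRelDepth {E : DirectedGraph V A} (C : E.Cyc) (x₀ : V) (d : ℕ) : ℕ :=
  {x : V | C.HasRelDepth x₀ x d}.ncard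

/-- The source of a generator: `s(v) = v` and `s(e^*) = r(e)`. -/
def genSrc (E : DirectedGraph V A) : Gen V A → V
  | .vert x => x
  | .edge e => E.src e
  | .ghost e => E.rng e

/-- The range of a generator: `r(v) = v` and `r(e^*) = s(e)`. -/
def genRng (E : DirectedGraph V A) : Gen V A → V
  | .vert x => x
  | .edge e => E.rng e
  | .ghost e => E.src e

/-- The relations shared by the Leavitt inverse semigroup and the Leavitt path algebra, for
generators placed in `S` by `g`. -/
inductive BaseRel (E : DirectedGraph V A) {S : Type w} [Mul S] [Zero S] (g : Gen V A → S) :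
    S → S → Prop
  /-- `s(a) a = a` -/
  | src_mul (a : Gen V A) : BaseRel E g (g (.vert (E.genSrc a)) * g a) (g a)
  /-- `a r(a) = a` -/
  | mul_rng (a : Gen V A) : BaseRel E g (g a * g (.vert (E.genRng a))) (g a)
  /-- `x y = 0` for distinct vertices -/
  | vert_mul_vert (x y : V) (h : x ≠ y) : BaseRel E g (g (.vert x) * g (.vert y)) 0
  /-- `e^* f = 0` for distinct edges -/
  | ghost_mul_edge (e f : A) (h : e ≠ f) : BaseRel E g (g (.ghost e) * g (.edge f)) 0
  /-- `e^* e = r(e)` -/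
  | ghost_mul_self (e : A) : BaseRel E g (g (.ghost e) * g (.edge e)) (g (.vert (E.rng e)))

/-- The product `p q^* = e₁ ⋯ eₙ y fₘ^* ⋯ f₁^*` of the generators `g`, for paths `p = e₁ ⋯ eₙ` and
`q = f₁ ⋯ fₘ` with common range `y`. (The vertex `y` is absorbed when `p` or `q` is not empty.) -/
def pathProd {S : Type w} [Mul S] (g : Gen V A → S) (p q : List A) (y : V) : S :=
  p.foldr (fun e t => g (.edge e) * t) (q.foldr (fun f t => t * g (.ghost f)) (g (.vert y)))

/-! ### The Leavitt inverse semigroup -/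

/-- A generator, in the free semigroup with zero. -/
def freeGen (a : Gen V A) : WithZero (FreeSemigroup (Gen V A)) :=
  (FreeSemigroup.of a : FreeSemigroup (Gen V A))

/-- The defining relations of the Leavitt inverse semigroup. -/
inductive LIRel (E : DirectedGraph V A) :
    WithZero (FreeSemigroup (Gen V A)) → WithZero (FreeSemigroup (Gen V A)) → Prop
  | base {a b : WithZero (FreeSemigroup (Gen V A))} (h : BaseRel E freeGen a b) : LIRel E a b
  /-- `x = e e^*` if the vertex `x = s(e)` has out-degree `1` -/
  | vert_eq (e : A) (h : E.outDegree (E.src e) = 1) :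
      LIRel E (freeGen (.vert (E.src e))) (freeGen (.edge e) * freeGen (.ghost e))

/-- The Leavitt inverse semigroup `LI(E)`: the semigroup with zero generated by
`E⁰ ∪ E¹ ∪ (E¹)^*` subject to the relations above. -/
def LI (E : DirectedGraph V A) : Type (max u v) :=
  (conGen (LIRel E)).Quotient

/-- The quotient map onto `LI(E)`. -/
def LI.mk (E : DirectedGraph V A) (a : WithZero (FreeSemigroup (Gen V A))) : LI E :=
  Con.toQuotient (c := conGen (LIRel E)) a

instance (E : DirectedGraph V A) : Semigroup (LI E) :=
  inferInstanceAs (Semigroup (conGen (LIRel E)).Quotient)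

instance (E : DirectedGraph V A) : SemigroupWithZero (LI E) where
  zero := LI.mk E 0
  zero_mul a := by
    induction a using Con.induction_on with
    | H x => exact congrArg (LI.mk E) (zero_mul x)
  mul_zero a := by
    induction a using Con.induction_on with
    | H x => exact congrArg (LI.mk E) (mul_zero x)

/-- The generators of `LI(E)`. -/
def LI.gen (E : DirectedGraph V A) (a : Gen V A) : LI E :=
  LI.mk E (freeGen a)

/-- The component of degree `n` of `LI(E)`: zero and the elements `p q^*` with `r(p) = r(q)` and
`|p| - |q| = n`. -/
def LI.component (E : DirectedGraph V A) (n : ℤ) : Set (LI E) :=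
  {t | t = 0 ∨ ∃ (p q : List A) (x x' y : V), E.IsPath x p y ∧ E.IsPath x' q y ∧
    (p.length : ℤ) - (q.length : ℤ) = n ∧ t = pathProd (LI.gen E) p q y}

/-- `LI(E) ≅_gr LI(F)`: there is a semigroup isomorphism that preserves the degrees. -/
def LI.GradedIso {V' : Type*} {A' : Type*} (E : DirectedGraph V A) (F : DirectedGraph V' A') :
    Prop :=
  ∃ φ : LI E ≃* LI F, ∀ n : ℤ, ∀ t ∈ LI.component E n, φ t ∈ LI.component F n

/-! ### The Leavitt path algebra -/

open Classical in
/-- The defining relations of the Leavitt path algebra of a finite graph. Mathlib's free algebra has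
a unit; the last relation identifies it with the unit `∑ x` that the other relations give to the
algebra generated by `E⁰ ∪ E¹ ∪ (E¹)^*` (the graph has finitely many vertices). -/
inductive LPARel (K : Type w) [Field K] [Fintype V] [Fintype A] (E : DirectedGraph V A) :
    FreeAlgebra K (Gen V A) → FreeAlgebra K (Gen V A) → Prop
  | base {a b : FreeAlgebra K (Gen V A)} (h : BaseRel E (FreeAlgebra.ι K) a b) : LPARel K E a b
  /-- `x = ∑ e e^*`, over the edges with source `x`, if `x` is not a sink -/
  | vert_eq (x : V) (h : ¬ E.IsSink x) :
      LPARel K E (FreeAlgebra.ι K (.vert x))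
        (∑ e ∈ Finset.univ.filter (fun e : A => E.src e = x),
          FreeAlgebra.ι K (.edge e) * FreeAlgebra.ι K (.ghost e))
  | sum_vert : LPARel K E (∑ x : V, FreeAlgebra.ι K (.vert x)) 1

/-- The Leavitt path algebra `L_K(E)` of a finite graph. -/
abbrev LPA (K : Type w) [Field K] [Fintype V] [Fintype A] (E : DirectedGraph V A) :
    Type (max u v w) :=
  RingQuot (LPARel K E)

/-- The generators of `L_K(E)`. -/
def LPA.gen (K : Type w) [Field K] [Fintype V] [Fintype A] (E : DirectedGraph V A)
    (a : Gen V A) : LPA K E :=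
  RingQuot.mkAlgHom K (LPARel K E) (FreeAlgebra.ι K a)

/-- The component of degree `n` of `L_K(E)`: the span of the elements `p q^*` with `r(p) = r(q)` and
`|p| - |q| = n`. -/
def LPA.component (K : Type w) [Field K] [Fintype V] [Fintype A] (E : DirectedGraph V A)
    (n : ℤ) : Submodule K (LPA K E) :=
  Submodule.span K
    {t | ∃ (p q : List A) (x x' y : V), E.IsPath x p y ∧ E.IsPath x' q y ∧
      (p.length : ℤ) - (q.length : ℤ) = n ∧ t = pathProd (LPA.gen K E) p q y}

/-- `L_K(E) ≅_gr L_K(F)`: there is a `K`-algebra isomorphism that preserves the degrees. -/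
def LPA.GradedIso (K : Type w) [Field K] [Fintype V] [Fintype A] {V' : Type*} {A' : Type*}
    [Fintype V'] [Fintype A'] (E : DirectedGraph V A) (F : DirectedGraph V' A') : Prop :=
  ∃ φ : LPA K E ≃ₐ[K] LPA K F, ∀ n : ℤ, ∀ t ∈ LPA.component K E n, φ t ∈ LPA.component K F n

end DirectedGraph

/-! When out-degrees are at most 1, a path is determined by its source and its length, and
connectedness makes every vertex flow into the cycle `C`. Since `e e^* = s(e)` for every edge, `p
q^*` is unchanged when `p` and `q` are prolonged by the same path. Hence a product `p q^*` depends
only on the sources `x`, `x'` of `p`, `q` and on the degree `n`. Sending it to `T ^ n` times the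
matrix unit at `(x, x')` embeds `LI(E)` in the matrices over the Laurent polynomials and identifies
`L_K(E)` with the span of the image (`LI.rep_injective`, `LPA.rep_injective`). Let `δ x`, modulo
`|C|`, be the distance from `x` to the base of `C`. The triples that occur are exactly those with `n
≡ δ x - δ x'` (`exists_paths`, `length_sub_eq`), so both objects are governed by `|C|` and the
differences of `δ`.

(3) ⇒ (2): a bijection of vertices preserving relative depth preserves the admissible triples, hence
permutes the matrix units. (2) ⇒ (1): the nonzero idempotents of `LI(E)` are the vertices, so an
isomorphism preserves their sum, the unit, and extends to the algebras by the universal property.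

(1) ⇒ (3): for a vertex `v`, the dimension of `L_n v` counts the `x` with `n ≡ δ x - δ v`, and `v
L_n v ≠ 0` exactly when `|C|` divides `n`. A graded isomorphism need not map vertices to vertices,
but it maps `v` to an idempotent equivalent in degree 0 to some vertex `w`
(`exists_vert_equivalent`), and equivalence preserves both invariants. Finally `w` is replaced by a
vertex of the cycle with the same potential. -/

namespace DirectedGraph
variable {V : Type u} {A : Type v} {E : DirectedGraph V A}

/-! ### Paths in graphs of out-degree at most 1 -/

theorem src_injective (h : ∀ x, E.outDegree x ≤ 1) : Function.Injective E.src := by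
  intro e f hef
  exact Set.encard_le_one_iff.1 (h (E.src e)) e f rfl hef.symm

theorem outDegree_src (h : ∀ x, E.outDegree x ≤ 1) (e : A) : E.outDegree (E.src e) = 1 := by
  refine le_antisymm (h _) ?_
  rw [outDegree, Set.one_le_encard_iff_nonempty]
  exact ⟨e, rfl⟩

theorem not_isSink_src (e : A) : ¬ E.IsSink (E.src e) := by
  intro h
  have := Set.encard_eq_zero.1 h
  exact (this ▸ (rfl : E.src e = E.src e) : e ∈ (∅ : Set A))

theorem exists_src_eq {x : V} (h : ¬ E.IsSink x) : ∃ e, E.src e = x := by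
  by_contra! hx
  exact h (Set.encard_eq_zero.2 (Set.eq_empty_of_forall_notMem hx))

theorem isPath_append {p q : List A} {x z : V} :
    E.IsPath x (p ++ q) z ↔ ∃ y, E.IsPath x p y ∧ E.IsPath y q z := by
  induction p generalizing x with
  | nil => simp [IsPath]
  | cons e p ih => simp [IsPath, ih, and_assoc]

/-- At each vertex there is at most one edge to follow, so paths with a common source are prefixes
of one another. -/
theorem IsPath.exists_append_of_length_le (hs : Function.Injective E.src) {x y z : V}
    {p q : List A} (hp : E.IsPath x p y) (hq : E.IsPath x q z) (hpq : p.length ≤ q.length) :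
    ∃ r, q = p ++ r ∧ E.IsPath y r z := by
  induction p generalizing x q with
  | nil => obtain rfl : x = y := hp; exact ⟨q, rfl, hq⟩
  | cons e p ih =>
    cases q with
    | nil => simp at hpq
    | cons f q =>
      obtain rfl : e = f := hs (hp.1.trans hq.1.symm)
      obtain ⟨r, rfl, hr⟩ := ih hp.2 hq.2 (by simpa using hpq)
      exact ⟨r, rfl, hr⟩

theorem IsPath.eq_of_length_eq (hs : Function.Injective E.src) {x y z : V}
    {p q : List A} (hp : E.IsPath x p y) (hq : E.IsPath x q z) (hpq : p.length = q.length) :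
    p = q := by
  obtain ⟨r, rfl, -⟩ := hp.exists_append_of_length_le hs hq hpq.le
  have : r = [] := by simpa using hpq
  simp [this]

/-- The path is cut at its first visit to `y`. -/
theorem IsPath.exists_avoiding {x y : V} {p : List A} (hp : E.IsPath x p y) :
    ∃ q, E.IsPath x q y ∧ ∀ e ∈ q, E.src e ≠ y := by
  induction p generalizing x with
  | nil => exact ⟨[], hp, by simp⟩
  | cons e p ih =>
    by_cases hx : x = y
    · exact ⟨[], hx, by simp⟩
    · obtain ⟨q, hq, hq'⟩ := ih hp.2
      refine ⟨e :: q, ⟨hp.1, hq⟩, ?_⟩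
      intro f hf
      rcases List.mem_cons.1 hf with rfl | hf
      · exact hp.1 ▸ hx
      · exact hq' f hf

/-! ### Cycles, potentials and relative depth -/

namespace Cyc
variable (C : E.Cyc)

/-- Induction along an undirected walk from the base. An edge read backwards is prepended to the
path; an edge read forwards is the first edge of the path, and is deleted. -/
theorem exists_isPath_base (hE : E.Connected) (hs : Function.Injective E.src) (x : V) :
    ∃ p, E.IsPath x p C.base := by
  induction hE C.base x with
  | refl => exact ⟨[], rfl⟩
  | tail _ h ih =>
    obtain ⟨p, hp⟩ := ih
    obtain ⟨e, ⟨he, hr⟩ | ⟨hr, he⟩⟩ := h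
    · have key : ∀ (q : List A) (b : V), E.src e = b → q ≠ [] → E.IsPath b q C.base →
          ∃ p, E.IsPath (E.rng e) p C.base := by
        rintro (_ | ⟨f, q⟩) b hb hq hp
        · exact absurd rfl hq
        · obtain rfl : f = e := hs (hp.1.trans hb.symm)
          exact ⟨q, hp.2⟩
      rw [← hr]
      -- An empty path has no edge to delete. The walk is then at the base, which is not a sink, and
      -- the nonempty cycle serves as the path.
      by_cases hnil : p = []
      · subst hnil
        refine key C.edges C.base (he.trans hp) ?_ C.isPath
        intro h0
        have := C.sink_of_nil h0
        rw [← (he.trans hp : E.src e = C.base)] at this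
        exact not_isSink_src e this
      · exact key p _ he hnil hp
    · exact ⟨e :: p, he, hr ▸ hp⟩

/-- Copies of `C` are stripped off until the rest is shorter than `C`. -/
theorem length_dvd (hs : Function.Injective E.src) (r : List A)
    (hr : E.IsPath C.base r C.base) : C.length ∣ r.length := by
  induction hn : r.length using Nat.strong_induction_on generalizing r with
  | _ n ih =>
    subst hn
    by_cases hnil : C.edges = []
    · cases r with
      | nil => simp
      | cons e r => exact absurd (hr.1 ▸ C.sink_of_nil hnil) (not_isSink_src e)
    have hpos : 0 < C.length := List.length_pos_iff.2 hnil
    rcases le_or_gt C.length r.length with h | h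
    · obtain ⟨q, rfl, hq⟩ := C.isPath.exists_append_of_length_le hs hr h
      rw [List.length_append]
      refine (Nat.dvd_add_right (dvd_refl _)).2 (ih _ ?_ q hq rfl)
      rw [List.length_append]
      have : 0 < C.edges.length := hpos
      omega
    -- The rest is a proper prefix of `C`. If it were nonempty, `C` would leave the base twice,
    -- against the distinctness of its sources.
    · obtain ⟨q, hq, hq'⟩ := hr.exists_append_of_length_le hs C.isPath h.le
      cases r with
      | nil => simp
      | cons e r =>
        cases q with
        | nil => simp [Cyc.length, hq] at h
        | cons f q =>
          obtain rfl : e = f := hs (hr.1.trans hq'.1.symm)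
          have := C.nodup
          rw [hq] at this
          simp at this

theorem IsOn.exists_isPath {C : E.Cyc} {x : V} (hx : C.IsOn x) : ∃ p, E.IsPath C.base p x := by
  rcases hx with rfl | hx
  · exact ⟨[], rfl⟩
  · obtain ⟨e, he, rfl⟩ := List.mem_map.1 hx
    obtain ⟨s, t, hst⟩ := List.append_of_mem he
    obtain ⟨y, hy, hy'⟩ := isPath_append.1 (hst ▸ C.isPath)
    exact ⟨s, hy'.1 ▸ hy⟩

theorem exists_isPath_mul (k : ℕ) :
    ∃ r, E.IsPath C.base r C.base ∧ r.length = k * C.length := by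
  induction k with
  | zero => exact ⟨[], rfl, by simp⟩
  | succ k ih =>
    obtain ⟨r, hr, hl⟩ := ih
    exact ⟨C.edges ++ r, isPath_append.2 ⟨_, C.isPath, hr⟩, by
      rw [List.length_append, hl, add_mul, one_mul, add_comm]; rfl⟩

/-- A function on the vertices, with values in the integers modulo the length of the cycle, whose
difference along a path is the length of the path. -/
structure IsPotential (δ : V → ZMod C.length) : Prop where
  exists_isPath_base : ∀ x, ∃ p, E.IsPath x p C.base
  length_eq : ∀ {x p y}, E.IsPath x p y → (p.length : ZMod C.length) = δ x - δ y

/-- Two paths from `x` to the base differ by a closed path at the base, whose length is a multiple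
of `|C|`. As `ZMod 0` is `ℤ`, sinks need no separate treatment. -/
theorem exists_isPotential (hE : E.Connected) (hs : Function.Injective E.src) :
    ∃ δ : V → ZMod C.length, C.IsPotential δ := by
  have hb := C.exists_isPath_base hE hs
  choose P hP using hb
  have aux : ∀ {x p q}, E.IsPath x p C.base → E.IsPath x q C.base → p.length ≤ q.length →
      (p.length : ZMod C.length) = q.length := by
    intro x p q hp hq h
    obtain ⟨r, rfl, hr⟩ := hp.exists_append_of_length_le hs hq h
    have := (ZMod.natCast_eq_zero_iff _ _).2 (C.length_dvd hs r hr)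
    simp [this]
  refine ⟨fun x => (P x).length, fun x => ⟨P x, hP x⟩, ?_⟩
  intro x p y hp
  have hpy : E.IsPath x (p ++ P y) C.base := isPath_append.2 ⟨y, hp, hP y⟩
  have : ((P x).length : ZMod C.length) = (p ++ P y).length := by
    rcases le_total (P x).length (p ++ P y).length with h | h
    · exact aux (hP x) hpy h
    · exact (aux hpy (hP x) h).symm
  rw [this]; simp

variable {C} {δ : V → ZMod C.length}

theorem IsPotential.exists_paths (hδ : C.IsPotential δ) {v w : V} {n : ℤ}
    (hn : (n : ZMod C.length) = δ v - δ w) :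
    ∃ p q y, E.IsPath v p y ∧ E.IsPath w q y ∧ (p.length : ℤ) - q.length = n := by
  obtain ⟨p, hp⟩ := hδ.exists_isPath_base v
  obtain ⟨q, hq⟩ := hδ.exists_isPath_base w
  have h : ((n - (p.length - q.length) : ℤ) : ZMod C.length) = 0 := by
    push_cast
    rw [hn, hδ.length_eq hp, hδ.length_eq hq]; ring
  obtain ⟨k, hk⟩ := (ZMod.intCast_zmod_eq_zero_iff_dvd _ _).1 h
  -- The discrepancy `k * |C|` is absorbed by winding around the cycle at the end of `p` or of `q`,
  -- according to the sign of `k`.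
  rcases Int.eq_nat_or_neg k with ⟨m, rfl | rfl⟩
  · obtain ⟨r, hr, hl⟩ := C.exists_isPath_mul m
    refine ⟨p ++ r, q, _, isPath_append.2 ⟨_, hp, hr⟩, hq, ?_⟩
    rw [List.length_append, hl]; push_cast; linarith
  · obtain ⟨r, hr, hl⟩ := C.exists_isPath_mul m
    refine ⟨p, q ++ r, _, hp, isPath_append.2 ⟨_, hq, hr⟩, ?_⟩
    rw [List.length_append, hl]; push_cast; linarith

theorem IsPotential.length_sub_eq (hδ : C.IsPotential δ) {x x' y : V} {p q : List A}
    (hp : E.IsPath x p y) (hq : E.IsPath x' q y) :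
    (((p.length : ℤ) - q.length : ℤ) : ZMod C.length) = δ x - δ x' := by
  push_cast
  rw [hδ.length_eq hp, hδ.length_eq hq]; ring

theorem IsPotential.hasRelDepth_iff (hδ : C.IsPotential δ) {x₀ x : V} (h₀ : C.IsOn x₀) {d : ℕ} :
    C.HasRelDepth x₀ x d ↔ d % C.length = d ∧ (d : ZMod C.length) = δ x - δ x₀ := by
  constructor
  · rintro ⟨p, hp, -, rfl⟩
    exact ⟨Nat.mod_mod _ _, by rw [ZMod.natCast_mod, hδ.length_eq hp]⟩
  · rintro ⟨hd, hd'⟩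
    obtain ⟨p, hp⟩ := hδ.exists_isPath_base x
    obtain ⟨q, hq⟩ := h₀.exists_isPath
    obtain ⟨r, hr, hr'⟩ := (isPath_append.2 ⟨_, hp, hq⟩ : E.IsPath x (p ++ q) x₀).exists_avoiding
    refine ⟨r, hr, hr', ?_⟩
    rw [← hδ.length_eq hr] at hd'
    rw [← hd]
    exact ((ZMod.natCast_eq_natCast_iff' _ _ _).1 hd').symm

theorem IsPotential.exists_hasRelDepth (hδ : C.IsPotential δ) {x₀ : V} (h₀ : C.IsOn x₀) (x : V) :
    ∃ d, C.HasRelDepth x₀ x d := by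
  obtain ⟨p, hp⟩ := hδ.exists_isPath_base x
  obtain ⟨q, hq⟩ := h₀.exists_isPath
  obtain ⟨r, hr, hr'⟩ := (isPath_append.2 ⟨_, hp, hq⟩ : E.IsPath x (p ++ q) x₀).exists_avoiding
  exact ⟨_, r, hr, hr', rfl⟩

theorem IsPotential.hasRelDepth_unique (hδ : C.IsPotential δ) {x₀ x : V} (h₀ : C.IsOn x₀)
    {d d' : ℕ} (h : C.HasRelDepth x₀ x d) (h' : C.HasRelDepth x₀ x d') : d = d' := by
  rw [hδ.hasRelDepth_iff h₀] at h h'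
  rw [← h.1, ← h'.1]
  exact (ZMod.natCast_eq_natCast_iff' _ _ _).1 (h.2.trans h'.2.symm)

/-- The potential drops by 1 along each edge, so `δ C.base - k` steps along the cycle lead from the
base to potential `k`. -/
theorem IsPotential.exists_isOn (hδ : C.IsPotential δ) (hC : C.length ≠ 0) (k : ZMod C.length) :
    ∃ x, C.IsOn x ∧ δ x = k := by
  have : NeZero C.length := ⟨hC⟩
  let i := (δ C.base - k).val
  have hi : i < C.edges.length := ZMod.val_lt _
  have h := C.isPath
  rw [← List.take_append_drop i C.edges] at h
  obtain ⟨y, hy, hy'⟩ := isPath_append.1 h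
  rw [List.drop_eq_getElem_cons hi] at hy'
  refine ⟨y, Or.inr (List.mem_map.2 ⟨_, List.getElem_mem hi, hy'.1⟩), ?_⟩
  have := hδ.length_eq hy
  rw [List.length_take_of_le hi.le, ZMod.natCast_zmod_val] at this
  linear_combination this

end Cyc

/-! ### Normal forms `p q^*` in a Leavitt family -/

/-- Elements of a semigroup with zero that satisfy the relations of the Leavitt inverse semigroup of
a graph in which all out-degrees are at most `1`. -/
structure LeavittFamily (E : DirectedGraph V A) {S : Type w} [SemigroupWithZero S]
    (g : Gen V A → S) : Prop where
  base : ∀ {a b : S}, BaseRel E g a b → a = b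
  vert_eq : ∀ e, g (.vert (E.src e)) = g (.edge e) * g (.ghost e)

/-- Zero and the products `p q^*` of a family. -/
inductive IsNormal (E : DirectedGraph V A) {S : Type w} [Mul S] [Zero S] (g : Gen V A → S) :
    S → Prop
  | zero : IsNormal E g 0
  | pathProd {p q : List A} {x x' y : V} (hp : E.IsPath x p y) (hq : E.IsPath x' q y) :
      IsNormal E g (pathProd g p q y)

namespace LeavittFamily
variable {S : Type w} [SemigroupWithZero S] {g : Gen V A → S}

theorem foldr_mul_assoc (a b : S) (q : List A) :
    q.foldr (fun f t => t * g (.ghost f)) (a * b) =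
      a * q.foldr (fun f t => t * g (.ghost f)) b := by
  induction q with
  | nil => rfl
  | cons f q ih => simp [ih, mul_assoc]

theorem vert_mul_self (h : LeavittFamily E g) (x : V) :
    g (.vert x) * g (.vert x) = g (.vert x) :=
  h.base (BaseRel.src_mul (.vert x))

theorem vert_mul_edge (h : LeavittFamily E g) (e : A) :
    g (.vert (E.src e)) * g (.edge e) = g (.edge e) :=
  h.base (BaseRel.src_mul (.edge e))

theorem edge_mul_vert (h : LeavittFamily E g) (e : A) :
    g (.edge e) * g (.vert (E.rng e)) = g (.edge e) :=
  h.base (BaseRel.mul_rng (.edge e))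

theorem vert_mul_ghost (h : LeavittFamily E g) (e : A) :
    g (.vert (E.rng e)) * g (.ghost e) = g (.ghost e) :=
  h.base (BaseRel.src_mul (.ghost e))

theorem vert_mul_pathProd (h : LeavittFamily E g) {x y : V} {p : List A} (q : List A)
    (hp : E.IsPath x p y) : g (.vert x) * pathProd g p q y = pathProd g p q y := by
  cases p with
  | nil =>
    obtain rfl : x = y := hp
    simp only [pathProd, List.foldr_nil]
    rw [← foldr_mul_assoc, h.vert_mul_self]
  | cons e p =>
    obtain ⟨rfl, -⟩ := hp
    simp only [pathProd, List.foldr_cons]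
    rw [← mul_assoc, h.vert_mul_edge]

/-- The last edge of a path contributes the leftmost ghost, so `e` meets `e^*` and relation (v)
replaces `e e^*` by `s(e)`. -/
theorem edge_mul_ghostProd (h : LeavittFamily E g) (e : A) (q : List A) :
    g (.edge e) * pathProd g [] (q ++ [e]) (E.rng e) = pathProd g [] q (E.src e) := by
  simp only [pathProd, List.foldr_nil, List.foldr_append, List.foldr_cons]
  rw [h.vert_mul_ghost, ← foldr_mul_assoc, ← h.vert_eq]

theorem pathProd_eq_foldr (p q : List A) (y : V) :
    pathProd g p q y = p.foldr (fun e t => g (.edge e) * t) (pathProd g [] q y) := rfl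

theorem pathProd_append (h : LeavittFamily E g) {p q r : List A} {y z : V}
    (hr : E.IsPath y r z) : pathProd g (p ++ r) (q ++ r) z = pathProd g p q y := by
  induction r generalizing p q y with
  | nil => obtain rfl : y = z := hr; simp
  | cons e r ih =>
    obtain ⟨rfl, hr⟩ := hr
    have := ih (p := p ++ [e]) (q := q ++ [e]) hr
    simp only [List.append_assoc, List.singleton_append] at this
    rw [this, pathProd_eq_foldr, List.foldr_append, List.foldr_cons, List.foldr_nil,
      h.edge_mul_ghostProd, ← pathProd_eq_foldr]

theorem isNormal_gen (h : LeavittFamily E g) (a : Gen V A) : IsNormal E g (g a) := by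
  cases a with
  | vert x => exact .pathProd (p := []) (q := []) (x := x) (x' := x) (y := x) rfl rfl
  | edge e =>
    have := IsNormal.pathProd (g := g) (E := E) (p := [e]) (q := []) (y := E.rng e)
      ⟨rfl, rfl⟩ rfl
    simpa [pathProd, h.edge_mul_vert] using this
  | ghost e =>
    have := IsNormal.pathProd (g := g) (E := E) (p := []) (q := [e]) (y := E.rng e)
      rfl ⟨rfl, rfl⟩
    simpa [pathProd, h.vert_mul_ghost] using this

theorem isNormal_gen_mul (h : LeavittFamily E g) (a : Gen V A) {t : S} (ht : IsNormal E g t) :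
    IsNormal E g (g a * t) := by
  cases ht with
  | zero => rw [mul_zero]; exact .zero
  | @pathProd p q x x' y hp hq =>
    by_cases hx : E.genRng a = x
    · subst hx
      cases a with
      | vert x => exact (h.vert_mul_pathProd q hp).symm ▸ .pathProd hp hq
      | edge e => exact .pathProd (p := e :: p) ⟨rfl, hp⟩ hq
      | ghost e =>
        have hr : g (.ghost e) * g (.edge e) = g (.vert (E.rng e)) :=
          h.base (.ghost_mul_self e)
        cases p with
        | nil =>
          obtain rfl : E.src e = y := hp
          -- With `p` empty, `q^*` is rewritten as `e (q e)^*`, so that `e^* e = r(e)` applies.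
          rw [← h.edge_mul_ghostProd, ← mul_assoc, hr,
            h.vert_mul_pathProd (p := []) _ rfl]
          exact .pathProd (p := []) rfl (isPath_append.2 ⟨_, hq, rfl, rfl⟩)
        | cons f p =>
          change IsNormal E g (g (.ghost e) * (g (.edge f) * pathProd g p q y))
          rw [← mul_assoc]
          by_cases hf : e = f
          · subst hf
            rw [hr, h.vert_mul_pathProd _ hp.2]
            exact .pathProd hp.2 hq
          · rw [h.base (.ghost_mul_edge e f hf), zero_mul]
            exact .zero
    · rw [← h.base (BaseRel.mul_rng a), ← h.vert_mul_pathProd q hp, mul_assoc,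
        ← mul_assoc (g (.vert (E.genRng a))), h.base (.vert_mul_vert _ _ hx), zero_mul, mul_zero]
      exact .zero

theorem pathProd_eq_of_length (h : LeavittFamily E g) (hs : Function.Injective E.src)
    {x x' y z : V} {p q p' q' : List A} (hp : E.IsPath x p y) (hq : E.IsPath x' q y)
    (hp' : E.IsPath x p' z) (hq' : E.IsPath x' q' z)
    (hl : (p.length : ℤ) - q.length = p'.length - q'.length) :
    pathProd g p q y = pathProd g p' q' z := by
  wlog hle : p.length ≤ p'.length generalizing p q p' q' y z
  · exact (this hp' hq' hp hq hl.symm (by omega)).symm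
  obtain ⟨r, rfl, hr⟩ := hp.exists_append_of_length_le hs hp' hle
  obtain ⟨r', rfl, hr'⟩ := hq.exists_append_of_length_le hs hq' (by omega)
  have : r = r' := hr.eq_of_length_eq hs hr' (by simp at hl; omega)
  subst this
  exact (h.pathProd_append hr).symm

end LeavittFamily

theorem BaseRel.map {S T : Type*} [SemigroupWithZero S] [SemigroupWithZero T] {g : Gen V A → S}
    (f : S →ₙ* T) (hf : f 0 = 0) {a b : S} (h : BaseRel E g a b) :
    BaseRel E (fun x => f (g x)) (f a) (f b) := by
  cases h with
  | src_mul a => rw [map_mul]; exact .src_mul a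
  | mul_rng a => rw [map_mul]; exact .mul_rng a
  | vert_mul_vert x y h => rw [map_mul, hf]; exact .vert_mul_vert x y h
  | ghost_mul_edge e f h => rw [map_mul, hf]; exact .ghost_mul_edge e f h
  | ghost_mul_self e => rw [map_mul]; exact .ghost_mul_self e

theorem LeavittFamily.of_map {S T : Type*} [SemigroupWithZero S] [SemigroupWithZero T]
    {g : Gen V A → S} (f : S →ₙ* T) (hf : f 0 = 0)
    (h : LeavittFamily E g) : LeavittFamily E (fun x => f (g x)) where
  base := by
    intro a b hab
    cases hab with
    | src_mul a => rw [← map_mul, h.base (.src_mul a)]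
    | mul_rng a => rw [← map_mul, h.base (.mul_rng a)]
    | vert_mul_vert x y hxy => rw [← map_mul, h.base (.vert_mul_vert x y hxy), hf]
    | ghost_mul_edge e f' hef => rw [← map_mul, h.base (.ghost_mul_edge e f' hef), hf]
    | ghost_mul_self e => rw [← map_mul, h.base (.ghost_mul_self e)]
  vert_eq e := by rw [h.vert_eq, map_mul]

theorem map_pathProd {S T : Type*} [Semigroup S] [Semigroup T] (f : S →ₙ* T) (g : Gen V A → S)
    (p q : List A) (y : V) : f (pathProd g p q y) = pathProd (fun x => f (g x)) p q y := by
  induction p with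
  | nil =>
    induction q with
    | nil => rfl
    | cons e q ih =>
      change f (pathProd g [] q y * g (.ghost e)) = pathProd (fun x => f (g x)) [] q y * _
      rw [map_mul, ih]
  | cons e p ih =>
    change f (g (.edge e) * pathProd g p q y) = _ * pathProd (fun x => f (g x)) p q y
    rw [map_mul, ih]

/-! ### The Leavitt inverse semigroup -/

theorem LI.mk_eq {a b : WithZero (FreeSemigroup (Gen V A))} (h : LIRel E a b) :
    LI.mk E a = LI.mk E b :=
  (Con.eq _).2 (ConGen.Rel.of _ _ h)

theorem LI.leavittFamily (hE : ∀ x, E.outDegree x ≤ 1) : LeavittFamily E (LI.gen E) where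
  base := by
    intro a b hab
    cases hab with
    | src_mul a => exact LI.mk_eq (.base (.src_mul a))
    | mul_rng a => exact LI.mk_eq (.base (.mul_rng a))
    | vert_mul_vert x y h => exact LI.mk_eq (.base (.vert_mul_vert x y h))
    | ghost_mul_edge e f h => exact LI.mk_eq (.base (.ghost_mul_edge e f h))
    | ghost_mul_self e => exact LI.mk_eq (.base (.ghost_mul_self e))
  vert_eq e := LI.mk_eq (.vert_eq e (outDegree_src hE e))

theorem LI.induction {motive : LI E → Prop} (zero : motive 0) (gen : ∀ a, motive (LI.gen E a))
    (gen_mul : ∀ a t, motive t → motive (LI.gen E a * t)) (t : LI E) : motive t := by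
  induction t using Con.induction_on with
  | H x =>
    induction x using WithZero.recZeroCoe with
    | zero => exact zero
    | coe s =>
      induction s using FreeSemigroup.recOnMul with
      | ih1 a => exact gen a
      | ih2 a s _ hs => exact gen_mul a _ hs

theorem LI.isNormal (hE : ∀ x, E.outDegree x ≤ 1) (t : LI E) : IsNormal E (LI.gen E) t := by
  induction t using LI.induction with
  | zero => exact .zero
  | gen a => exact (LI.leavittFamily hE).isNormal_gen a
  | gen_mul a t ht => exact (LI.leavittFamily hE).isNormal_gen_mul a ht

section Lift
variable {S : Type w} [SemigroupWithZero S] (g : Gen V A → S)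

/-- The homomorphism from the free semigroup with zero that extends `g`. -/
def freeLift : WithZero (FreeSemigroup (Gen V A)) →ₙ* S where
  toFun a := a.recZeroCoe 0 (FreeSemigroup.lift g)
  map_mul' a b := by
    induction a using WithZero.recZeroCoe with
    | zero => exact (zero_mul _).symm
    | coe s =>
      induction b using WithZero.recZeroCoe with
      | zero => exact (mul_zero _).symm
      | coe t => exact map_mul (FreeSemigroup.lift g) s t

variable {g}

theorem LIRel.freeLift_eq (h : LeavittFamily E g) {a b : WithZero (FreeSemigroup (Gen V A))}
    (hab : LIRel E a b) : freeLift g a = freeLift g b := by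
  cases hab with
  | base hab => exact h.base (hab.map (freeLift g) rfl)
  | vert_eq e _ => rw [map_mul]; exact h.vert_eq e

/-- The homomorphism from `LI(E)` given by a family of elements that satisfy its relations. -/
def LI.lift (h : LeavittFamily E g) : LI E →ₙ* S where
  toFun t := Con.liftOn t (freeLift g) fun a b hab => by
    have : conGen (LIRel E) ≤ Con.ker (freeLift g) :=
      Con.conGen_le.2 fun a b hab => LIRel.freeLift_eq h hab
    exact this hab
  map_mul' a b := by
    induction a using Con.induction_on with
    | H x =>
      induction b using Con.induction_on with
      | H y => exact map_mul (freeLift g) x y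

theorem LI.lift_gen (h : LeavittFamily E g) (a : Gen V A) : LI.lift h (LI.gen E a) = g a := rfl

theorem LI.lift_pathProd (h : LeavittFamily E g) (p q : List A) (y : V) :
    LI.lift h (pathProd (LI.gen E) p q y) = pathProd g p q y :=
  map_pathProd (LI.lift h) (LI.gen E) p q y

end Lift

/-! ### Matrix units over the Laurent polynomials -/

section MatrixFamily
variable (K : Type w) [Field K] [DecidableEq V]

/-- The matrix with entry `T ^ n` at `(x, y)` and zeros elsewhere. -/
noncomputable def matUnit (x y : V) (n : ℤ) : Matrix V V (LaurentPolynomial K) :=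
  Matrix.single x y (LaurentPolynomial.T n)

variable {K}

theorem matUnit_mul_matUnit [Fintype V] (x y z : V) (m n : ℤ) :
    matUnit K x y m * matUnit K y z n = matUnit K x z (m + n) := by
  rw [matUnit, matUnit, Matrix.single_mul_single_same, ← LaurentPolynomial.T_add, matUnit]

theorem matUnit_mul_of_ne [Fintype V] {y y' : V} (h : y ≠ y') (x z : V) (m n : ℤ) :
    matUnit K x y m * matUnit K y' z n = 0 := by
  rw [matUnit, matUnit, Matrix.single_mul_single_of_ne _ _ _ _ h]

theorem matUnit_coeff (x y : V) (n : ℤ) (x' y' : V) (n' : ℤ) :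
    (matUnit K x y n x' y').coeff n' = if x = x' ∧ y = y' ∧ n = n' then 1 else 0 := by
  rw [matUnit, Matrix.single_apply]
  by_cases h : x = x' ∧ y = y'
  · simp [h]
  · rw [if_neg h, if_neg (fun h' => h ⟨h'.1, h'.2.1⟩)]; rfl

theorem matUnit_ne_zero (x y : V) (n : ℤ) : matUnit K x y n ≠ 0 := by
  intro h
  have := matUnit_coeff (K := K) x y n x y n
  rw [h] at this
  simp at this

theorem matUnit_inj {x y x' y' : V} {n n' : ℤ} (h : matUnit K x y n = matUnit K x' y' n') :
    x = x' ∧ y = y' ∧ n = n' := by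
  have := matUnit_coeff (K := K) x y n x y n
  rw [h, matUnit_coeff] at this
  by_contra hne
  rw [if_neg (fun h => hne ⟨h.1.symm, h.2.1.symm, h.2.2.symm⟩)] at this
  simp at this

variable (K) in
/-- The images of the generators in the matrices over the Laurent polynomials. -/
noncomputable def matGen (E : DirectedGraph V A) : Gen V A → Matrix V V (LaurentPolynomial K)
  | .vert x => matUnit K x x 0
  | .edge e => matUnit K (E.src e) (E.rng e) 1
  | .ghost e => matUnit K (E.rng e) (E.src e) (-1)

theorem matGen_leavittFamily [Fintype V] (hs : Function.Injective E.src) : LeavittFamily E (matGen K E) where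
  base := by
    intro a b hab
    cases hab with
    | src_mul a => cases a <;> simp [matGen, genSrc, matUnit_mul_matUnit]
    | mul_rng a => cases a <;> simp [matGen, genRng, matUnit_mul_matUnit]
    | vert_mul_vert x y h => exact matUnit_mul_of_ne h _ _ _ _
    | ghost_mul_edge e f h => exact matUnit_mul_of_ne (hs.ne h) _ _ _ _
    | ghost_mul_self e => simp [matGen, matUnit_mul_matUnit]
  vert_eq e := by simp [matGen, matUnit_mul_matUnit]

theorem pathProd_matGen [Fintype V] {x x' y : V} {p q : List A} (hp : E.IsPath x p y)
    (hq : E.IsPath x' q y) :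
    pathProd (matGen K E) p q y = matUnit K x x' (p.length - q.length) := by
  induction p generalizing x with
  | nil =>
    obtain rfl : x = y := hp
    induction q generalizing x' with
    | nil => obtain rfl : x' = x := hq; simp [pathProd, matGen]
    | cons f q ih =>
      change pathProd (matGen K E) [] q x * matUnit K (E.rng f) (E.src f) (-1) = _
      obtain ⟨rfl, hq⟩ := hq
      rw [ih hq, matUnit_mul_matUnit]
      congr 1
      simp; ring
  | cons e p ih =>
    obtain ⟨rfl, hp⟩ := hp
    change matUnit K (E.src e) (E.rng e) 1 * pathProd (matGen K E) p q y = _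
    rw [ih hp, matUnit_mul_matUnit]
    congr 1
    simp; ring

end MatrixFamily

/-! ### The faithful representation of the inverse semigroup -/

section LI
variable (K : Type w) [Field K] [Fintype V] [DecidableEq V]

/-- The representation of `LI(E)` by matrices over the Laurent polynomials. -/
noncomputable def LI.rep (hs : Function.Injective E.src) :
    LI E →ₙ* Matrix V V (LaurentPolynomial K) :=
  LI.lift (matGen_leavittFamily hs)

variable {K}

theorem LI.rep_zero (hs : Function.Injective E.src) : LI.rep K hs 0 = 0 := rfl

theorem LI.rep_gen (hs : Function.Injective E.src) (a : Gen V A) :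
    LI.rep K hs (LI.gen E a) = matGen K E a := rfl

theorem LI.rep_pathProd (hs : Function.Injective E.src) {x x' y : V} {p q : List A}
    (hp : E.IsPath x p y) (hq : E.IsPath x' q y) :
    LI.rep K hs (pathProd (LI.gen E) p q y) = matUnit K x x' (p.length - q.length) := by
  rw [LI.rep, LI.lift_pathProd, pathProd_matGen hp hq]

variable (K) in
-- The image of a nonzero normal form records both sources and the degree, which determine it.
theorem LI.rep_injective (hE : ∀ x, E.outDegree x ≤ 1) :
    Function.Injective (LI.rep K (src_injective hE)) := by
  intro s t hst
  cases LI.isNormal hE s with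
  | zero =>
    cases LI.isNormal hE t with
    | zero => rfl
    | pathProd hp hq =>
      rw [LI.rep_zero, LI.rep_pathProd _ hp hq] at hst
      exact absurd hst.symm (matUnit_ne_zero _ _ _)
  | pathProd hp hq =>
    cases LI.isNormal hE t with
    | zero =>
      rw [LI.rep_zero, LI.rep_pathProd _ hp hq] at hst
      exact absurd hst (matUnit_ne_zero _ _ _)
    | pathProd hp' hq' =>
      rw [LI.rep_pathProd _ hp hq, LI.rep_pathProd _ hp' hq'] at hst
      obtain ⟨rfl, rfl, hl⟩ := matUnit_inj hst
      exact (LI.leavittFamily hE).pathProd_eq_of_length (src_injective hE) hp hq hp' hq' hl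

end LI

/-! ### The faithful representation of the algebra -/

section LPA
variable (K : Type w) [Field K] [Fintype V] [Fintype A]

open Classical in
theorem LPA.leavittFamily (hE : ∀ x, E.outDegree x ≤ 1) : LeavittFamily E (LPA.gen K E) where
  base := by
    intro a b hab
    have key : ∀ {a b}, BaseRel E (FreeAlgebra.ι K) a b →
        RingQuot.mkAlgHom K (LPARel K E) a = RingQuot.mkAlgHom K (LPARel K E) b :=
      fun h => RingQuot.mkAlgHom_rel K (.base h)
    cases hab with
    | src_mul a => exact (map_mul _ _ _).symm.trans (key (.src_mul a))
    | mul_rng a => exact (map_mul _ _ _).symm.trans (key (.mul_rng a))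
    | vert_mul_vert x y h => exact (map_mul _ _ _).symm.trans ((key (.vert_mul_vert x y h)).trans (map_zero _))
    | ghost_mul_edge e f h => exact (map_mul _ _ _).symm.trans ((key (.ghost_mul_edge e f h)).trans (map_zero _))
    | ghost_mul_self e => exact (map_mul _ _ _).symm.trans (key (.ghost_mul_self e))
  vert_eq e := by
    have := RingQuot.mkAlgHom_rel K (LPARel.vert_eq (K := K) (E.src e) (not_isSink_src e))
    have he : Finset.univ.filter (fun f => E.src f = E.src e) = {e} := by
      ext f
      simpa using ⟨fun h => src_injective hE h, fun h => h ▸ rfl⟩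
    rw [he, Finset.sum_singleton, map_mul] at this
    exact this

theorem LPA.sum_vert : ∑ x : V, LPA.gen K E (.vert x) = 1 := by
  have := RingQuot.mkAlgHom_rel K (LPARel.sum_vert (K := K) (E := E))
  rwa [map_sum, map_one] at this

variable {K}

open Classical in
theorem LPARel.lift_eq {B : Type*} [Ring B] [Algebra K B] {g : Gen V A → B}
    (hs : Function.Injective E.src) (h : LeavittFamily E g) (h1 : ∑ x, g (.vert x) = 1)
    {a b : FreeAlgebra K (Gen V A)} (hab : LPARel K E a b) :
    FreeAlgebra.lift K g a = FreeAlgebra.lift K g b := by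
  cases hab with
  | base hab =>
    have := hab.map (FreeAlgebra.lift K g : FreeAlgebra K (Gen V A) →ₙ* B)
      (map_zero (FreeAlgebra.lift K g))
    simp only [MulHom.coe_coe, FreeAlgebra.lift_ι_apply] at this
    exact h.base this
  | vert_eq x hx =>
    obtain ⟨e, rfl⟩ := exists_src_eq hx
    have he : Finset.univ.filter (fun f => E.src f = E.src e) = {e} := by
      ext f
      simpa using ⟨fun h => hs h, fun h => h ▸ rfl⟩
    rw [he, Finset.sum_singleton, map_mul]
    simpa using h.vert_eq e
  | sum_vert => simpa using h1

/-- The algebra homomorphism from `L_K(E)` given by a family that satisfies its relations. -/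
noncomputable def LPA.lift {B : Type*} [Ring B] [Algebra K B] {g : Gen V A → B}
    (hs : Function.Injective E.src) (h : LeavittFamily E g) (h1 : ∑ x, g (.vert x) = 1) :
    LPA K E →ₐ[K] B :=
  RingQuot.liftAlgHom K ⟨FreeAlgebra.lift K g, fun _ _ hab => LPARel.lift_eq hs h h1 hab⟩

theorem LPA.lift_gen {B : Type*} [Ring B] [Algebra K B] {g : Gen V A → B}
    (hs : Function.Injective E.src) (h : LeavittFamily E g) (h1 : ∑ x, g (.vert x) = 1)
    (a : Gen V A) : LPA.lift hs h h1 (LPA.gen K E a) = g a := by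
  simp [LPA.lift, LPA.gen]

theorem LPA.algHom_ext {B : Type*} [Ring B] [Algebra K B] {f g : LPA K E →ₐ[K] B}
    (h : ∀ a, f (LPA.gen K E a) = g (LPA.gen K E a)) : f = g := by
  apply RingQuot.ringQuot_ext'
  apply FreeAlgebra.hom_ext
  funext a
  exact h a

/-- The span is stable under left multiplication by generators and contains 1, the sum of the
vertices. -/
theorem LPA.span_isNormal (hE : ∀ x, E.outDegree x ≤ 1) :
    Submodule.span K {t | IsNormal E (LPA.gen K E) t} = ⊤ := by
  set N := Submodule.span K {t | IsNormal E (LPA.gen K E) t} with hN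
  have hmul : ∀ a : FreeAlgebra K (Gen V A), ∀ t ∈ N,
      RingQuot.mkAlgHom K (LPARel K E) a * t ∈ N := by
    intro a
    induction a using FreeAlgebra.induction with
    | grade0 r =>
      intro t ht
      rw [AlgHom.commutes, Algebra.algebraMap_eq_smul_one, smul_mul_assoc, one_mul]
      exact N.smul_mem r ht
    | grade1 a =>
      intro t ht
      induction ht using Submodule.span_induction with
      | mem t ht => exact Submodule.subset_span ((LPA.leavittFamily K hE).isNormal_gen_mul a ht)
      | zero => rw [mul_zero]; exact N.zero_mem
      | add s t _ _ hs ht => rw [mul_add]; exact N.add_mem hs ht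
      | smul r t _ ht => rw [mul_smul_comm]; exact N.smul_mem r ht
    | mul a b ha hb => intro t ht; rw [map_mul, mul_assoc]; exact ha _ (hb t ht)
    | add a b ha hb => intro t ht; rw [map_add, add_mul]; exact N.add_mem (ha t ht) (hb t ht)
  have h1 : (1 : LPA K E) ∈ N := by
    rw [← LPA.sum_vert]
    exact N.sum_mem fun x _ =>
      Submodule.subset_span ((LPA.leavittFamily K hE).isNormal_gen (.vert x))
  rw [eq_top_iff]
  rintro x -
  obtain ⟨a, rfl⟩ := RingQuot.mkAlgHom_surjective K (LPARel K E) x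
  simpa using hmul a 1 h1

variable (K) in
/-- The representation of `L_K(E)` by matrices over the Laurent polynomials. -/
noncomputable def LPA.rep [DecidableEq V] (hs : Function.Injective E.src) :
    LPA K E →ₐ[K] Matrix V V (LaurentPolynomial K) :=
  LPA.lift hs (matGen_leavittFamily hs) (by
    simpa [matGen, matUnit] using Matrix.sum_single_one)

variable [DecidableEq V]

theorem LPA.rep_gen (hs : Function.Injective E.src) (a : Gen V A) :
    LPA.rep K hs (LPA.gen K E a) = matGen K E a :=
  LPA.lift_gen _ _ _ a

theorem LPA.rep_pathProd (hs : Function.Injective E.src) {x x' y : V} {p q : List A}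
    (hp : E.IsPath x p y) (hq : E.IsPath x' q y) :
    LPA.rep K hs (pathProd (LPA.gen K E) p q y) = matUnit K x x' (p.length - q.length) := by
  have := map_pathProd (LPA.rep K hs : LPA K E →ₙ* Matrix V V (LaurentPolynomial K))
    (LPA.gen K E) p q y
  simp only [MulHom.coe_coe, LPA.rep_gen] at this
  rw [this, pathProd_matGen hp hq]

/-- The coefficient of `T ^ n` in the entry at `(x, y)`. -/
noncomputable def LPA.coeff (hs : Function.Injective E.src) (x y : V) (n : ℤ) :
    LPA K E →ₗ[K] K where
  toFun t := (LPA.rep K hs t x y).coeff n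
  map_add' s t := by simp
  map_smul' r t := by simp

theorem LPA.coeff_pathProd (hs : Function.Injective E.src) {x x' y : V} {p q : List A}
    (hp : E.IsPath x p y) (hq : E.IsPath x' q y) (z z' : V) (n : ℤ) :
    LPA.coeff hs z z' n (pathProd (LPA.gen K E) p q y) =
      if x = z ∧ x' = z' ∧ (p.length - q.length : ℤ) = n then 1 else 0 := by
  change (LPA.rep K hs _ z z').coeff n = _
  rw [LPA.rep_pathProd hs hp hq, matUnit_coeff]

/-- The functional at `(x, x', n)` is 1 on the normal form with these data and 0 on all others, so
it reads off a coefficient of `t` in the spanning set of normal forms. -/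
theorem LPA.eq_zero_of_coeff (hE : ∀ x, E.outDegree x ≤ 1) {t : LPA K E}
    (ht : ∀ x y n, LPA.coeff (src_injective hE) x y n t = 0) : t = 0 := by
  have hmem : t ∈ Submodule.span K {t | IsNormal E (LPA.gen K E) t} := by
    rw [LPA.span_isNormal hE]; trivial
  obtain ⟨c, rfl⟩ := (Finsupp.mem_span_iff_linearCombination K _ _).1 hmem
  rw [Finsupp.linearCombination_apply, Finsupp.sum] at ht ⊢
  refine Finset.sum_eq_zero fun i hi => ?_
  obtain ⟨t, hi'⟩ := i
  cases id hi' with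
  | zero => exact smul_zero _
  | @pathProd p q x x' y hp hq =>
    have h := ht x x' (p.length - q.length)
    rw [map_sum, Finset.sum_eq_single_of_mem _ hi] at h
    · rw [map_smul, LPA.coeff_pathProd _ hp hq, if_pos ⟨rfl, rfl, rfl⟩, smul_eq_mul, mul_one] at h
      rw [h, zero_smul]
    · rintro ⟨s, hs⟩ - hne
      cases id hs with
      | zero => rw [smul_zero, map_zero]
      | @pathProd p' q' z z' y' hp' hq' =>
        rw [map_smul, LPA.coeff_pathProd _ hp' hq', if_neg, smul_zero]
        rintro ⟨rfl, rfl, hl⟩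
        exact hne (Subtype.ext ((LPA.leavittFamily K hE).pathProd_eq_of_length
          (src_injective hE) hp' hq' hp hq hl))

theorem LPA.rep_injective (hE : ∀ x, E.outDegree x ≤ 1) :
    Function.Injective (LPA.rep K (src_injective hE)) := by
  rw [injective_iff_map_eq_zero]
  intro t ht
  refine LPA.eq_zero_of_coeff hE fun x y n => ?_
  change (LPA.rep K (src_injective hE) t x y).coeff n = 0
  rw [ht]; rfl

end LPA

/-! ### From the inverse semigroup to the algebra -/

theorem LI.hom_ext {S : Type*} [SemigroupWithZero S] {f g : LI E →ₙ* S} (h0 : f 0 = g 0)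
    (h : ∀ a, f (LI.gen E a) = g (LI.gen E a)) (t : LI E) : f t = g t := by
  induction t using LI.induction with
  | zero => exact h0
  | gen a => exact h a
  | gen_mul a t ht => rw [map_mul, map_mul, h, ht]

theorem LI.mulEquiv_zero {V' A' : Type*} {F : DirectedGraph V' A'} (φ : LI E ≃* LI F) : φ 0 = 0 := by
  have h := map_mul φ 0 (φ.symm 0)
  rwa [zero_mul, φ.apply_symm_apply, mul_zero] at h

/-- A square of `T ^ n` at `(x, x')` is nonzero only if `x = x'`, and then `2n = n`. -/
theorem LI.exists_vert_of_idempotent [Fintype V] (hE : ∀ x, E.outDegree x ≤ 1) {t : LI E} (h0 : t ≠ 0)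
    (ht : t * t = t) : ∃ x, t = LI.gen E (.vert x) := by
  classical
  cases LI.isNormal hE t with
  | zero => exact absurd rfl h0
  | @pathProd p q x x' y hp hq =>
    have h := congrArg (LI.rep ℚ (src_injective hE)) ht
    rw [map_mul, LI.rep_pathProd _ hp hq] at h
    have hx : x' = x := by
      by_contra hne
      rw [matUnit_mul_of_ne hne] at h
      exact matUnit_ne_zero _ _ _ h.symm
    subst hx
    rw [matUnit_mul_matUnit] at h
    have hn := (matUnit_inj h).2.2
    refine ⟨x', LI.rep_injective ℚ hE ?_⟩
    rw [LI.rep_pathProd _ hp hq, LI.rep_gen, matGen]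
    congr 1
    linarith

theorem LI.gen_vert_injective [Fintype V] (hE : ∀ x, E.outDegree x ≤ 1) :
    Function.Injective fun x => LI.gen E (.vert x) := by
  classical
  intro x y h
  exact (matUnit_inj (congrArg (LI.rep ℚ (src_injective hE)) h)).1

theorem LI.gen_vert_ne_zero [Fintype V] (hE : ∀ x, E.outDegree x ≤ 1) (x : V) :
    LI.gen E (.vert x) ≠ 0 := by
  classical
  intro h
  exact matUnit_ne_zero _ _ _ (congrArg (LI.rep ℚ (src_injective hE)) h)

theorem LI.exists_mulEquiv_vert [Fintype V] {V' A' : Type*} [Fintype V']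
    {F : DirectedGraph V' A'} (hE : ∀ x, E.outDegree x ≤ 1) (hF : ∀ x, F.outDegree x ≤ 1)
    (φ : LI E ≃* LI F) (x : V) : ∃ y, φ (LI.gen E (.vert x)) = LI.gen F (.vert y) := by
  refine LI.exists_vert_of_idempotent hF ?_ ?_
  · rw [← LI.mulEquiv_zero φ]
    exact φ.injective.ne (LI.gen_vert_ne_zero hE x)
  · rw [← map_mul, (LI.leavittFamily hE).vert_mul_self]

section Functor
variable (K : Type w) [Field K] [Fintype V] [Fintype A]

/-- The homomorphism `LI(E) → L_K(E)` that maps generators to generators. -/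
noncomputable def LI.toLPA (hE : ∀ x, E.outDegree x ≤ 1) : LI E →ₙ* LPA K E :=
  LI.lift (LPA.leavittFamily K hE)

theorem LI.toLPA_zero (hE : ∀ x, E.outDegree x ≤ 1) : LI.toLPA K hE 0 = 0 := rfl

theorem LI.toLPA_gen (hE : ∀ x, E.outDegree x ≤ 1) (a : Gen V A) :
    LI.toLPA K hE (LI.gen E a) = LPA.gen K E a := rfl

theorem LI.toLPA_pathProd (hE : ∀ x, E.outDegree x ≤ 1) (p q : List A) (y : V) :
    LI.toLPA K hE (pathProd (LI.gen E) p q y) = pathProd (LPA.gen K E) p q y :=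
  LI.lift_pathProd (LPA.leavittFamily K hE) p q y

theorem LI.toLPA_mem_component (hE : ∀ x, E.outDegree x ≤ 1) {n : ℤ} {t : LI E}
    (ht : t ∈ LI.component E n) : LI.toLPA K hE t ∈ LPA.component K E n := by
  rcases ht with rfl | ⟨p, q, x, x', y, hp, hq, hn, rfl⟩
  · exact Submodule.zero_mem _
  · exact Submodule.subset_span ⟨p, q, x, x', y, hp, hq, hn, LI.toLPA_pathProd K hE p q y⟩

variable {V' A' : Type*} [Fintype V'] [Fintype A'] {F : DirectedGraph V' A'}

omit [Fintype A] in
-- Both `φ` and its inverse map vertices to vertices, so the sum is merely reordered.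
theorem LI.sum_mulEquiv_vert (hE : ∀ x, E.outDegree x ≤ 1) (hF : ∀ x, F.outDegree x ≤ 1)
    (φ : LI E ≃* LI F) : ∑ x, LI.toLPA K hF (φ (LI.gen E (.vert x))) = 1 := by
  choose τ hτ using LI.exists_mulEquiv_vert hE hF φ
  have hbij : Function.Bijective τ := by
    constructor
    · intro x y h
      refine LI.gen_vert_injective hE (φ.injective ?_)
      change φ (LI.gen E (.vert x)) = φ (LI.gen E (.vert y))
      rw [hτ, hτ, h]
    · intro y
      obtain ⟨x, hx⟩ := LI.exists_mulEquiv_vert hF hE φ.symm y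
      refine ⟨x, LI.gen_vert_injective hF ?_⟩
      change LI.gen F (.vert (τ x)) = LI.gen F (.vert y)
      rw [← hτ, ← hx, φ.apply_symm_apply]
  rw [← LPA.sum_vert (K := K) (E := F), ← hbij.sum_comp]
  exact Finset.sum_congr rfl fun x _ => by rw [hτ, LI.toLPA_gen]

/-- The algebra homomorphism induced by an isomorphism of Leavitt inverse semigroups. -/
noncomputable def LPA.map (hE : ∀ x, E.outDegree x ≤ 1) (hF : ∀ x, F.outDegree x ≤ 1)
    (φ : LI E ≃* LI F) : LPA K E →ₐ[K] LPA K F :=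
  LPA.lift (src_injective hE)
    ((LI.leavittFamily hE).of_map ((LI.toLPA K hF).comp (φ : LI E →ₙ* LI F))
      (congrArg (LI.toLPA K hF) (LI.mulEquiv_zero φ)))
    (LI.sum_mulEquiv_vert K hE hF φ)

theorem LPA.map_toLPA (hE : ∀ x, E.outDegree x ≤ 1) (hF : ∀ x, F.outDegree x ≤ 1)
    (φ : LI E ≃* LI F) (t : LI E) :
    LPA.map K hE hF φ (LI.toLPA K hE t) = LI.toLPA K hF (φ t) := by
  refine LI.hom_ext (f := (LPA.map K hE hF φ : LPA K E →ₙ* LPA K F).comp (LI.toLPA K hE))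
    (g := (LI.toLPA K hF).comp (φ : LI E →ₙ* LI F)) ?_ (fun a => ?_) t
  · change LPA.map K hE hF φ (LI.toLPA K hE 0) = LI.toLPA K hF (φ 0)
    rw [LI.mulEquiv_zero, LI.toLPA_zero, LI.toLPA_zero, map_zero]
  · exact LPA.lift_gen _ _ _ a

theorem LPA.map_comp_map (hE : ∀ x, E.outDegree x ≤ 1) (hF : ∀ x, F.outDegree x ≤ 1)
    (φ : LI E ≃* LI F) :
    (LPA.map K hF hE φ.symm).comp (LPA.map K hE hF φ) = AlgHom.id K (LPA K E) := by
  refine LPA.algHom_ext fun a => ?_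
  change LPA.map K hF hE φ.symm (LPA.map K hE hF φ (LPA.gen K E a)) = LPA.gen K E a
  rw [← LI.toLPA_gen K hE, LPA.map_toLPA, LPA.map_toLPA, φ.symm_apply_apply]

theorem LPA.gradedIso_of_LI (hE : ∀ x, E.outDegree x ≤ 1) (hF : ∀ x, F.outDegree x ≤ 1)
    (h : LI.GradedIso E F) : LPA.GradedIso K E F := by
  obtain ⟨φ, hφ⟩ := h
  refine ⟨AlgEquiv.ofAlgHom (LPA.map K hE hF φ) (LPA.map K hF hE φ.symm)
    (LPA.map_comp_map K hF hE φ.symm) (LPA.map_comp_map K hE hF φ), fun n t ht => ?_⟩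
  change LPA.map K hE hF φ t ∈ _
  suffices LPA.component K E n ≤
      (LPA.component K F n).comap (LPA.map K hE hF φ).toLinearMap from this ht
  refine Submodule.span_le.2 ?_
  rintro _ ⟨p, q, x, x', y, hp, hq, hn, rfl⟩
  change LPA.map K hE hF φ _ ∈ LPA.component K F n
  rw [← LI.toLPA_pathProd K hE, LPA.map_toLPA]
  exact LI.toLPA_mem_component K hF (hφ n _ (Or.inr ⟨p, q, x, x', y, hp, hq, hn, rfl⟩))

end Functor

/-! ### From relative depths to the inverse semigroup -/

section Reindex
variable [Fintype V] {V' A' : Type*} [Fintype V'] {F : DirectedGraph V' A'}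

theorem reindex_matUnit [DecidableEq V] [DecidableEq V'] (K : Type*) [Field K] (σ : V ≃ V')
    (x y : V) (n : ℤ) :
    Matrix.reindexAlgEquiv K (LaurentPolynomial K) σ (matUnit K x y n) =
      matUnit K (σ x) (σ y) n := by
  rw [Matrix.coe_reindexAlgEquiv, Matrix.reindex_apply, matUnit,
    Matrix.submatrix_single_equiv]
  simp [matUnit]

/-- By `hσ`, reindexing matrices along `σ` carries the image of `LI(E)` onto that of `LI(F)`. The
isomorphism is read off from the faithful representations; the field `ℚ` is an arbitrary choice. -/
theorem LI.gradedIso_of_equiv (hE : ∀ x, E.outDegree x ≤ 1) (hF : ∀ x, F.outDegree x ≤ 1)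
    {C₁ : E.Cyc} {C₂ : F.Cyc} {δ₁ : V → ZMod C₁.length} {δ₂ : V' → ZMod C₂.length}
    (h₁ : C₁.IsPotential δ₁) (h₂ : C₂.IsPotential δ₂) (σ : V ≃ V')
    (hσ : ∀ x y (n : ℤ), (n : ZMod C₁.length) = δ₁ x - δ₁ y ↔
      (n : ZMod C₂.length) = δ₂ (σ x) - δ₂ (σ y)) : LI.GradedIso E F := by
  classical
  let θ := Matrix.reindexAlgEquiv ℚ (LaurentPolynomial ℚ) σ
  let ρ₁ := LI.rep ℚ (src_injective hE)
  let ρ₂ := LI.rep ℚ (src_injective hF)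
  have inj₁ : Function.Injective ρ₁ := LI.rep_injective ℚ hE
  have inj₂ : Function.Injective ρ₂ := LI.rep_injective ℚ hF
  have fwd : ∀ {p q x x' y}, E.IsPath x p y → E.IsPath x' q y →
      ∃ p' q' y', F.IsPath (σ x) p' y' ∧ F.IsPath (σ x') q' y' ∧
        (p'.length : ℤ) - q'.length = p.length - q.length ∧
        ρ₂ (pathProd (LI.gen F) p' q' y') = θ (ρ₁ (pathProd (LI.gen E) p q y)) := by
    intro p q x x' y hp hq
    obtain ⟨p', q', y', hp', hq', hl⟩ := h₂.exists_paths ((hσ _ _ _).1 (h₁.length_sub_eq hp hq))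
    refine ⟨p', q', y', hp', hq', hl, ?_⟩
    rw [LI.rep_pathProd _ hp' hq', LI.rep_pathProd _ hp hq, reindex_matUnit, hl]
  have hex : ∀ t, ∃ s, ρ₂ s = θ (ρ₁ t) := by
    intro t
    cases LI.isNormal hE t with
    | zero => exact ⟨0, (map_zero θ).symm⟩
    | pathProd hp hq =>
      obtain ⟨p', q', y', -, -, -, h⟩ := fwd hp hq
      exact ⟨_, h⟩
  choose f hf using hex
  have hbij : Function.Bijective f := by
    constructor
    · intro s t h
      refine inj₁ (θ.injective ?_)
      rw [← hf, ← hf, h]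
    · intro s
      cases LI.isNormal hF s with
      | zero => exact ⟨0, inj₂ ((hf 0).trans (map_zero θ))⟩
      | @pathProd p q x x' y hp hq =>
        obtain ⟨p', q', y', hp', hq', hl⟩ := h₁.exists_paths
          (v := σ.symm x) (w := σ.symm x') (n := p.length - q.length) ((hσ _ _ _).2 (by
            rw [σ.apply_symm_apply, σ.apply_symm_apply]; exact h₂.length_sub_eq hp hq))
        refine ⟨pathProd (LI.gen E) p' q' y', inj₂ ?_⟩
        rw [hf, LI.rep_pathProd _ hp' hq', LI.rep_pathProd _ hp hq, reindex_matUnit, hl,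
          σ.apply_symm_apply, σ.apply_symm_apply]
  let φ : LI E →ₙ* LI F := ⟨f, fun s t => inj₂ (by rw [map_mul, hf, hf, hf, map_mul, map_mul])⟩
  refine ⟨MulEquiv.ofBijective φ hbij, fun n t ht => ?_⟩
  change f t ∈ _
  rcases ht with rfl | ⟨p, q, x, x', y, hp, hq, rfl, rfl⟩
  · exact Or.inl (inj₂ ((hf 0).trans (map_zero θ)))
  · obtain ⟨p', q', y', hp', hq', hl, h⟩ := fwd hp hq
    exact Or.inr ⟨p', q', _, _, y', hp', hq', hl, inj₂ ((hf _).trans h.symm)⟩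

theorem exists_equiv_of_ncard_fiber_eq {ι : Type*} {f : V → ι} {g : V' → ι}
    (h : ∀ i, {x | f x = i}.ncard = {y | g y = i}.ncard) : ∃ σ : V ≃ V', ∀ x, g (σ x) = f x := by
  have : ∀ i, Nonempty ({x // f x = i} ≃ {y // g y = i}) := fun i =>
    Finite.card_eq.1 (h i)
  let e := fun i => (this i).some
  refine ⟨(Equiv.sigmaFiberEquiv f).symm.trans
    ((Equiv.sigmaCongrRight e).trans (Equiv.sigmaFiberEquiv g)), fun x => ?_⟩
  exact (e (f x) ⟨x, rfl⟩).2

theorem LI.gradedIso_of_numRelDepth (hE : E.Connected) (hF : F.Connected)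
    (hE1 : ∀ x, E.outDegree x ≤ 1) (hF1 : ∀ x, F.outDegree x ≤ 1) (C₁ : E.Cyc) (C₂ : F.Cyc)
    (hC : C₁.length = C₂.length) {v₀ : V} {w₀ : V'} (hv : C₁.IsOn v₀) (hw : C₂.IsOn w₀)
    (hd : ∀ d, C₁.numRelDepth v₀ d = C₂.numRelDepth w₀ d) : LI.GradedIso E F := by
  obtain ⟨δ₁, h₁⟩ := C₁.exists_isPotential hE (src_injective hE1)
  obtain ⟨δ₂, h₂⟩ := C₂.exists_isPotential hF (src_injective hF1)
  choose D₁ hD₁ using h₁.exists_hasRelDepth hv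
  choose D₂ hD₂ using h₂.exists_hasRelDepth hw
  have eq₁ : ∀ d, {x | C₁.HasRelDepth v₀ x d} = {x | D₁ x = d} := fun d => Set.ext fun x =>
    ⟨fun h => h₁.hasRelDepth_unique hv (hD₁ x) h, fun h => h ▸ hD₁ x⟩
  have eq₂ : ∀ d, {x | C₂.HasRelDepth w₀ x d} = {x | D₂ x = d} := fun d => Set.ext fun x =>
    ⟨fun h => h₂.hasRelDepth_unique hw (hD₂ x) h, fun h => h ▸ hD₂ x⟩
  obtain ⟨σ, hσ⟩ := exists_equiv_of_ncard_fiber_eq (f := D₁) (g := D₂) fun d => by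
    rw [← eq₁, ← eq₂]; exact hd d
  refine LI.gradedIso_of_equiv hE1 hF1 h₁ h₂ σ fun x y n => ?_
  -- Depth and potential differ by the constant `δ₁ v₀`, which cancels in differences.
  have e₁ : ∀ x y, δ₁ x - δ₁ y = ((D₁ x - D₁ y : ℤ) : ZMod C₁.length) := by
    intro x y
    push_cast
    rw [((h₁.hasRelDepth_iff hv).1 (hD₁ x)).2, ((h₁.hasRelDepth_iff hv).1 (hD₁ y)).2]; ring
  have e₂ : ∀ x y, δ₂ x - δ₂ y = ((D₂ x - D₂ y : ℤ) : ZMod C₂.length) := by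
    intro x y
    push_cast
    rw [((h₂.hasRelDepth_iff hw).1 (hD₂ x)).2, ((h₂.hasRelDepth_iff hw).1 (hD₂ y)).2]; ring
  rw [e₁, e₂, hσ, hσ, ZMod.intCast_eq_intCast_iff_dvd_sub, ZMod.intCast_eq_intCast_iff_dvd_sub,
    hC]

end Reindex
variable {K : Type w} [Field K] [Fintype V] [Fintype A]

/-! ### Homogeneous components and matrix coefficients -/

section Components
variable [DecidableEq V]

theorem LPA.coeff_eq_zero_of_mem_component (hs : Function.Injective E.src) {n m : ℤ} (hm : m ≠ n)
    (x y : V) {t : LPA K E} (ht : t ∈ LPA.component K E n) : LPA.coeff hs x y m t = 0 := by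
  suffices LPA.component K E n ≤ LinearMap.ker (LPA.coeff hs x y m) from this ht
  refine Submodule.span_le.2 ?_
  rintro _ ⟨p, q, z, z', y, hp, hq, rfl, rfl⟩
  rw [SetLike.mem_coe, LinearMap.mem_ker, LPA.coeff_pathProd hs hp hq,
    if_neg fun h => hm h.2.2.symm]

variable {C : E.Cyc} {δ : V → ZMod C.length}

theorem LPA.coeff_eq_zero_of_ne (hE : ∀ x, E.outDegree x ≤ 1) (hδ : C.IsPotential δ) {x y : V}
    {n : ℤ} (h : (n : ZMod C.length) ≠ δ x - δ y) (t : LPA K E) :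
    LPA.coeff (src_injective hE) x y n t = 0 := by
  suffices Submodule.span K {t | IsNormal E (LPA.gen K E) t} ≤
      LinearMap.ker (LPA.coeff (src_injective hE) x y n) from
    this (by rw [LPA.span_isNormal hE]; trivial)
  refine Submodule.span_le.2 fun t ht => ?_
  rw [SetLike.mem_coe, LinearMap.mem_ker]
  cases id ht with
  | zero => exact map_zero _
  | pathProd hp hq =>
    rw [LPA.coeff_pathProd _ hp hq, if_neg]
    rintro ⟨rfl, rfl, rfl⟩
    exact h (hδ.length_sub_eq hp hq)

theorem LPA.exists_rep_eq_matUnit (hs : Function.Injective E.src) (hδ : C.IsPotential δ) {x y : V}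
    {n : ℤ} (h : (n : ZMod C.length) = δ x - δ y) :
    ∃ t ∈ LPA.component K E n, LPA.rep K hs t = matUnit K x y n := by
  obtain ⟨p, q, z, hp, hq, hl⟩ := hδ.exists_paths h
  exact ⟨_, Submodule.subset_span ⟨p, q, x, y, z, hp, hq, hl, rfl⟩, by
    rw [LPA.rep_pathProd hs hp hq, hl]⟩

/-- The product of two spanning elements is identified, through the faithful representation, with
zero or with one spanning element of the right degree. -/
theorem LPA.mul_mem_component (hE : ∀ x, E.outDegree x ≤ 1) (hδ : C.IsPotential δ) {m n : ℤ}
    {s t : LPA K E} (hs : s ∈ LPA.component K E m) (ht : t ∈ LPA.component K E n) :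
    s * t ∈ LPA.component K E (m + n) := by
  suffices LPA.component K E m * LPA.component K E n ≤ LPA.component K E (m + n) from
    this (Submodule.mul_mem_mul hs ht)
  rw [LPA.component, LPA.component, Submodule.span_mul_span, Submodule.span_le]
  rintro _ ⟨_, ⟨p, q, x, x', y, hp, hq, rfl, rfl⟩, _, ⟨p', q', z, z', y', hp', hq', rfl, rfl⟩, rfl⟩
  change pathProd (LPA.gen K E) p q y * pathProd (LPA.gen K E) p' q' y' ∈ _
  by_cases h : x' = z
  · subst h
    obtain ⟨t, ht, hrep⟩ := LPA.exists_rep_eq_matUnit (K := K) (src_injective hE) hδ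
      (x := x) (y := z') (n := (p.length - q.length) + (p'.length - q'.length)) (by
        rw [Int.cast_add, hδ.length_sub_eq hp hq, hδ.length_sub_eq hp' hq']; ring)
    have key : pathProd (LPA.gen K E) p q y * pathProd (LPA.gen K E) p' q' y' = t :=
      LPA.rep_injective hE (by
        rw [map_mul, LPA.rep_pathProd _ hp hq, LPA.rep_pathProd _ hp' hq', matUnit_mul_matUnit,
          hrep])
    exact key ▸ ht
  · have key : pathProd (LPA.gen K E) p q y * pathProd (LPA.gen K E) p' q' y' = 0 :=
      LPA.rep_injective hE (by
        rw [map_mul, LPA.rep_pathProd _ hp hq, LPA.rep_pathProd _ hp' hq', matUnit_mul_of_ne h,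
          map_zero])
    rw [key]
    exact Submodule.zero_mem _

omit [DecidableEq V] in
theorem LPA.iSup_component (hE : ∀ x, E.outDegree x ≤ 1) : ⨆ n, LPA.component K E n = ⊤ := by
  rw [eq_top_iff, ← LPA.span_isNormal hE]
  refine Submodule.span_le.2 fun t ht => ?_
  cases id ht with
  | zero => exact Submodule.zero_mem _
  | pathProd hp hq =>
    exact Submodule.mem_iSup_of_mem _ (Submodule.subset_span ⟨_, _, _, _, _, hp, hq, rfl, rfl⟩)

omit [DecidableEq V] in
theorem LPA.gen_vert_mem_component (x : V) :
    LPA.gen K E (.vert x) ∈ LPA.component K E 0 :=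
  Submodule.subset_span ⟨[], [], x, x, x, rfl, rfl, rfl, rfl⟩

theorem LPA.gen_vert_ne_zero (hs : Function.Injective E.src) (x : V) :
    LPA.gen K E (.vert x) ≠ 0 := by
  intro h
  have := LPA.rep_gen (K := K) hs (.vert x)
  rw [h, map_zero] at this
  exact matUnit_ne_zero _ _ _ this.symm

theorem LPA.coeff_mul_vert (hs : Function.Injective E.src) (x y z : V) (n : ℤ) (t : LPA K E) :
    LPA.coeff hs x y n (t * LPA.gen K E (.vert z)) =
      if y = z then LPA.coeff hs x y n t else 0 := by
  change (LPA.rep K hs _ x y).coeff n = if y = z then (LPA.rep K hs t x y).coeff n else 0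
  rw [map_mul, LPA.rep_gen, matGen, matUnit]
  split_ifs with h
  · subst h
    rw [Matrix.mul_single_apply_same, LaurentPolynomial.T_zero, mul_one]
  · rw [Matrix.mul_single_apply_of_ne (hbj := h)]; rfl

theorem LPA.coeff_vert_mul (hs : Function.Injective E.src) (x y z : V) (n : ℤ) (t : LPA K E) :
    LPA.coeff hs x y n (LPA.gen K E (.vert z) * t) =
      if x = z then LPA.coeff hs x y n t else 0 := by
  change (LPA.rep K hs _ x y).coeff n = if x = z then (LPA.rep K hs t x y).coeff n else 0
  rw [map_mul, LPA.rep_gen, matGen, matUnit]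
  split_ifs with h
  · subst h
    rw [Matrix.single_mul_apply_same, LaurentPolynomial.T_zero, one_mul]
  · rw [Matrix.single_mul_apply_of_ne (h := h)]; rfl

/-- In degree 0 every matrix entry is a scalar, and `u` moves the entry at `(x, y)` to the diagonal.
-/
theorem LPA.vert_mul_mul_eq_smul (hE : ∀ x, E.outDegree x ≤ 1) {x y : V} {t u : LPA K E}
    (ht : t ∈ LPA.component K E 0) (hu : LPA.rep K (src_injective hE) u = matUnit K y x 0) :
    LPA.gen K E (.vert x) * t * u =
      LPA.coeff (src_injective hE) x y 0 t • LPA.gen K E (.vert x) := by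
  refine LPA.rep_injective hE ?_
  rw [map_mul, map_mul, map_smul, LPA.rep_gen, hu, matGen, matUnit, matUnit,
    Matrix.single_mul_mul_single, Matrix.smul_single, LaurentPolynomial.T_zero, one_mul, mul_one]
  congr 1
  refine LaurentPolynomial.ext fun n => ?_
  change LPA.coeff (src_injective hE) x y n t = _
  rw [AddMonoidAlgebra.coeff_smul, ← LaurentPolynomial.T_zero]
  by_cases hn : n = 0
  · subst hn; simp
  · rw [LPA.coeff_eq_zero_of_mem_component _ hn x y ht]
    simp [LaurentPolynomial.T_apply, -LaurentPolynomial.T_zero, Ne.symm hn]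

end Components

/-- Evaluating `g f u f u` in two ways gives `c² g = d c g`, so `d = c`. After division by `c`, the
elements `f u` and `g f` realize the equivalence of the idempotents `f` and `g`. -/
theorem mul_eq_of_compressions {B : Type*} [Ring B] [Algebra K B] {f g u : B} {c d : K}
    (hff : f * f = f) (hg0 : g ≠ 0) (hc : c ≠ 0) (hgfu : g * f * u = c • g) (hug : u * g = u)
    (hd : f * u * f = d • f) :
    (c⁻¹ • (f * u)) * (g * f) = f ∧ (g * f) * (c⁻¹ • (f * u)) = g := by
  have hcd : d = c := by
    have h : (c * c) • g = (d * c) • g := by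
      calc (c * c) • g = c • (g * f * u) := by rw [hgfu, smul_smul]
        _ = (c • g) * f * u := by rw [smul_mul_assoc, smul_mul_assoc]
        _ = g * (f * u * f) * u := by rw [← hgfu]; simp only [mul_assoc]
        _ = (d * c) • g := by
          rw [hd, mul_smul_comm, smul_mul_assoc, hgfu, smul_smul]
    exact (mul_right_cancel₀ hc (smul_left_injective K hg0 h)).symm
  constructor
  · rw [smul_mul_assoc, mul_assoc, ← mul_assoc u, hug, ← mul_assoc, hd, hcd, smul_smul,
      inv_mul_cancel₀ hc, one_smul]
  · rw [mul_smul_comm, mul_assoc, ← mul_assoc f, hff, ← mul_assoc, hgfu, smul_smul,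
      inv_mul_cancel₀ hc, one_smul]

/-! ### Graded invariants of a vertex: columns and corners -/

section Column

/-- The elements of a subspace that are fixed by right multiplication by `e`. -/
def column {B : Type*} [Ring B] [Algebra K B] (L : Submodule K B) (e : B) : Submodule K B where
  carrier := {x | x ∈ L ∧ x * e = x}
  add_mem' hx hy := ⟨L.add_mem hx.1 hy.1, by rw [add_mul, hx.2, hy.2]⟩
  zero_mem' := ⟨L.zero_mem, zero_mul _⟩
  smul_mem' r x hx := ⟨L.smul_mem r hx.1, by rw [smul_mul_assoc, hx.2]⟩

variable {C : E.Cyc} {δ : V → ZMod C.length}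

/-- A basis is given by the elements representing `T ^ n` at `(x, v)`, one for each admissible `x`.
-/
theorem LPA.finrank_column (hE : ∀ x, E.outDegree x ≤ 1) (hδ : C.IsPotential δ) (v : V) (n : ℤ) :
    Module.finrank K (column (LPA.component K E n) (LPA.gen K E (.vert v))) =
      {x | (n : ZMod C.length) = δ x - δ v}.ncard := by
  classical
  have hs := src_injective hE
  let f : column (LPA.component K E n) (LPA.gen K E (.vert v)) →ₗ[K]
      ({x | (n : ZMod C.length) = δ x - δ v} → K) :=
    (LinearMap.pi fun x => LPA.coeff hs x.1 v n).comp (Submodule.subtype _)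
  have hf : Function.Bijective f := by
    constructor
    · rw [injective_iff_map_eq_zero]
      rintro ⟨t, ht, htv⟩ h0
      refine Subtype.ext (LPA.eq_zero_of_coeff hE fun x y m => ?_)
      change LPA.coeff hs x y m t = 0
      by_cases hm : m = n
      · subst hm
        by_cases hy : y = v
        · subst hy
          by_cases hx : (m : ZMod C.length) = δ x - δ y
          · exact congrFun h0 ⟨x, hx⟩
          · exact LPA.coeff_eq_zero_of_ne hE hδ hx t
        · rw [← htv, LPA.coeff_mul_vert, if_neg hy]
      · exact LPA.coeff_eq_zero_of_mem_component hs hm x y ht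
    · intro c
      choose U hU hrep using fun x : {x | (n : ZMod C.length) = δ x - δ v} =>
        LPA.exists_rep_eq_matUnit (K := K) hs hδ x.2
      have hUv : ∀ x, U x * LPA.gen K E (.vert v) = U x := fun x => LPA.rep_injective hE (by
        rw [map_mul, hrep, LPA.rep_gen, matGen, matUnit_mul_matUnit, add_zero])
      refine ⟨⟨∑ x, c x • U x, Submodule.sum_mem _ fun x _ => Submodule.smul_mem _ _ (hU x), ?_⟩,
        ?_⟩
      · rw [Finset.sum_mul]
        exact Finset.sum_congr rfl fun x _ => by rw [smul_mul_assoc, hUv]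
      · funext z
        change LPA.coeff hs z.1 v n (∑ x, c x • U x) = c z
        have hco : ∀ x, LPA.coeff hs z.1 v n (U x) = if x = z then 1 else 0 := by
          intro x
          change (LPA.rep K hs (U x) z.1 v).coeff n = _
          rw [hrep, matUnit_coeff]
          simp [Subtype.ext_iff]
        simp [map_sum, hco]
  rw [(LinearEquiv.ofBijective f hf).finrank_eq, Module.finrank_fintype_fun_eq_card,
    ← Nat.card_eq_fintype_card]
  rfl

theorem LPA.exists_corner_ne_zero_iff (hE : ∀ x, E.outDegree x ≤ 1) (hδ : C.IsPotential δ) (v : V)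
    (n : ℤ) : (∃ t ∈ LPA.component K E n, t ≠ 0 ∧ LPA.gen K E (.vert v) * t = t ∧
      t * LPA.gen K E (.vert v) = t) ↔ (C.length : ℤ) ∣ n := by
  classical
  have hs := src_injective hE
  rw [← ZMod.intCast_zmod_eq_zero_iff_dvd]
  constructor
  · rintro ⟨t, ht, h0, h1, h2⟩
    by_contra hn
    refine h0 (LPA.eq_zero_of_coeff hE fun x y m => ?_)
    by_cases hm : m = n
    · subst hm
      by_cases hx : x = v
      · by_cases hy : y = v
        · subst hx hy
          exact LPA.coeff_eq_zero_of_ne hE hδ (by rwa [sub_self]) t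
        · rw [← h2, LPA.coeff_mul_vert, if_neg hy]
      · rw [← h1, LPA.coeff_vert_mul, if_neg hx]
    · exact LPA.coeff_eq_zero_of_mem_component hs hm x y ht
  · intro hn
    obtain ⟨t, ht, hrep⟩ := LPA.exists_rep_eq_matUnit (K := K) hs hδ (x := v) (y := v) (n := n)
      (by rw [hn, sub_self])
    refine ⟨t, ht, ?_, LPA.rep_injective hE ?_, LPA.rep_injective hE ?_⟩
    · rintro rfl
      rw [map_zero] at hrep
      exact matUnit_ne_zero _ _ _ hrep.symm
    · rw [map_mul, hrep, LPA.rep_gen, matGen, matUnit_mul_matUnit, zero_add]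
    · rw [map_mul, hrep, LPA.rep_gen, matGen, matUnit_mul_matUnit, add_zero]

end Column

/-! ### Invariance under graded isomorphisms -/

section GradedIso
variable {V' A' : Type*} [Fintype V'] [Fintype A'] {F : DirectedGraph V' A'}
  {C₁ : E.Cyc} {C₂ : F.Cyc} {δ₁ : V → ZMod C₁.length} {δ₂ : V' → ZMod C₂.length}

/-- The components span `L_K(E)`, and matrix coefficients separate degrees in `L_K(F)`. Thus the
parts of `φ.symm t` of degree other than `n` have image zero, hence vanish. -/
theorem LPA.symm_mem_component (hE : ∀ x, E.outDegree x ≤ 1) (hF : ∀ x, F.outDegree x ≤ 1)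
    {φ : LPA K E ≃ₐ[K] LPA K F}
    (hφ : ∀ n, ∀ t ∈ LPA.component K E n, φ t ∈ LPA.component K F n) {n : ℤ} {t : LPA K F}
    (ht : t ∈ LPA.component K F n) : φ.symm t ∈ LPA.component K E n := by
  classical
  have hmem : φ.symm t ∈ ⨆ n, LPA.component K E n := by rw [LPA.iSup_component hE]; trivial
  obtain ⟨f, hf, hsum⟩ := (Submodule.mem_iSup_iff_exists_finsupp _ _).1 hmem
  have hzero : ∀ m, m ≠ n → f m = 0 := by
    intro m hm
    refine φ.injective ?_
    rw [map_zero]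
    refine LPA.eq_zero_of_coeff hF fun x y k => ?_
    by_cases hk : k = m
    · subst hk
      have h := congrArg (LPA.coeff (src_injective hF) x y k) (φ.apply_symm_apply t)
      rw [LPA.coeff_eq_zero_of_mem_component _ hm x y ht, ← hsum, Finsupp.sum, map_sum, map_sum] at h
      rw [← h]
      symm
      refine Finset.sum_eq_single k (fun j _ hj => ?_) (fun hk => ?_)
      · exact LPA.coeff_eq_zero_of_mem_component _ hj.symm x y (hφ j _ (hf j))
      · rw [Finsupp.notMem_support_iff.1 hk, map_zero, map_zero]
    · exact LPA.coeff_eq_zero_of_mem_component _ hk x y (hφ m _ (hf m))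
  rw [← hsum, Finsupp.sum]
  refine Submodule.sum_mem _ fun m _ => ?_
  by_cases hm : m = n
  · exact hm ▸ hf m
  · rw [hzero m hm]; exact Submodule.zero_mem _

/-- A graded isomorphism maps a vertex to an idempotent that is equivalent, by means of elements of
degree `0`, to a vertex. -/
theorem LPA.exists_vert_equivalent (hE : ∀ x, E.outDegree x ≤ 1) (hF : ∀ x, F.outDegree x ≤ 1)
    (h₂ : C₂.IsPotential δ₂) {φ : LPA K E ≃ₐ[K] LPA K F}
    (hφ : ∀ n, ∀ t ∈ LPA.component K E n, φ t ∈ LPA.component K F n) (v : V) :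
    ∃ w, ∃ a ∈ LPA.component K F 0, ∃ b ∈ LPA.component K F 0,
      a * b = φ (LPA.gen K E (.vert v)) ∧ b * a = LPA.gen K F (.vert w) := by
  classical
  obtain ⟨f, hf⟩ : ∃ f, f = φ (LPA.gen K E (.vert v)) := ⟨_, rfl⟩
  rw [← hf]
  have hff : f * f = f := by
    rw [hf, ← map_mul, (LPA.leavittFamily K hE).vert_mul_self]
  have hf0 : f ≠ 0 := by
    rw [hf, ← map_zero φ]
    exact φ.injective.ne (LPA.gen_vert_ne_zero (src_injective hE) v)
  have hfmem : f ∈ LPA.component K F 0 := hf ▸ hφ 0 _ (LPA.gen_vert_mem_component v)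
  obtain ⟨w, w', hc⟩ : ∃ w w', LPA.coeff (src_injective hF) w w' 0 f ≠ 0 := by
    by_contra! h
    refine hf0 (LPA.eq_zero_of_coeff hF fun x y n => ?_)
    by_cases hn : n = 0
    · exact hn ▸ h x y
    · exact LPA.coeff_eq_zero_of_mem_component _ hn x y hfmem
  have hδ : ((0 : ℤ) : ZMod C₂.length) = δ₂ w - δ₂ w' := by
    by_contra h
    exact hc (LPA.coeff_eq_zero_of_ne hF h₂ h f)
  -- A nonzero coefficient of `f` forces `δ₂ w = δ₂ w'`, so the transposed matrix unit occurs in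
  -- degree 0.
  obtain ⟨u, hu, hrep⟩ := LPA.exists_rep_eq_matUnit (K := K) (src_injective hF) h₂
    (x := w') (y := w) (n := 0) (by rw [← neg_sub, ← hδ]; simp)
  obtain ⟨g, hg⟩ : ∃ g, g = LPA.gen K F (.vert w) := ⟨_, rfl⟩
  have hg0 : g ≠ 0 := hg ▸ LPA.gen_vert_ne_zero (src_injective hF) w
  obtain ⟨c, hc, hgfu⟩ : ∃ c : K, c ≠ 0 ∧ g * f * u = c • g :=
    ⟨_, hc, hg ▸ LPA.vert_mul_mul_eq_smul hF hfmem hrep⟩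
  have hug : u * g = u := LPA.rep_injective hF (by
    rw [hg, map_mul, hrep, LPA.rep_gen, matGen, matUnit_mul_matUnit, add_zero])
  -- Pulled back along `φ`, this is the compression of a degree 0 element by the vertex `v`, which
  -- is a multiple of `v`.
  obtain ⟨d, hd⟩ : ∃ d : K, f * u * f = d • f := by
    have := LPA.vert_mul_mul_eq_smul hE (x := v) (LPA.symm_mem_component hE hF hφ hu)
      (LPA.rep_gen (src_injective hE) (.vert v))
    refine ⟨LPA.coeff (src_injective hE) v v 0 (φ.symm u), ?_⟩
    rw [hf, ← map_smul, ← this, map_mul, map_mul, φ.apply_symm_apply]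
  have h := mul_eq_of_compressions hff hg0 hc hgfu hug hd
  have hmul : ∀ {s t : LPA K F}, s ∈ LPA.component K F 0 → t ∈ LPA.component K F 0 →
      s * t ∈ LPA.component K F 0 := fun hs ht => by
    simpa using LPA.mul_mem_component hF h₂ hs ht
  exact ⟨w, c⁻¹ • (f * u), Submodule.smul_mem _ _ (hmul hfmem hu), g * f,
    hmul (hg ▸ LPA.gen_vert_mem_component w) hfmem, h.1, hg ▸ h.2⟩

section Equivalent
variable {φ : LPA K E ≃ₐ[K] LPA K F} {e : LPA K E} {f a b : LPA K F}

/-- Right multiplication by `a` after `φ` is inverted by right multiplication by `b` followed by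
`φ.symm`. -/
theorem LPA.finrank_column_eq (hE : ∀ x, E.outDegree x ≤ 1) (hF : ∀ x, F.outDegree x ≤ 1)
    (h₂ : C₂.IsPotential δ₂)
    (hφ : ∀ n, ∀ t ∈ LPA.component K E n, φ t ∈ LPA.component K F n)
    (ha : a ∈ LPA.component K F 0) (hb : b ∈ LPA.component K F 0) (hab : a * b = φ e)
    (hba : b * a = f) (n : ℤ) :
    Module.finrank K (column (LPA.component K E n) e) =
      Module.finrank K (column (LPA.component K F n) f) := by
  classical
  have hmul : ∀ {s t : LPA K F}, s ∈ LPA.component K F n → t ∈ LPA.component K F 0 →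
      s * t ∈ LPA.component K F n := fun hs ht => by
    simpa using LPA.mul_mem_component hF h₂ hs ht
  refine LinearEquiv.finrank_eq
    { toFun := fun x => ⟨φ x.1 * a, hmul (hφ n _ x.2.1) ha, ?_⟩
      map_add' := fun x y => Subtype.ext (by simp [add_mul])
      map_smul' := fun r x => Subtype.ext (by simp)
      invFun := fun y => ⟨φ.symm (y.1 * b),
        LPA.symm_mem_component hE hF hφ (hmul y.2.1 hb), ?_⟩
      left_inv := fun x => Subtype.ext ?_
      right_inv := fun y => Subtype.ext ?_ }
  · rw [← hba, mul_assoc, ← mul_assoc a, hab, ← mul_assoc, ← map_mul, x.2.2]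
  · refine φ.injective ?_
    rw [map_mul, φ.apply_symm_apply, ← hab, mul_assoc, ← mul_assoc b, hba, ← mul_assoc, y.2.2]
  · change φ.symm (φ x.1 * a * b) = x.1
    rw [mul_assoc, hab, ← map_mul, x.2.2, φ.symm_apply_apply]
  · change φ (φ.symm (y.1 * b)) * a = y.1
    rw [φ.apply_symm_apply, mul_assoc, hba, y.2.2]

/-- The corners correspond under `t ↦ b * φ t * a` and `t ↦ φ.symm (a * t * b)`. -/
theorem LPA.exists_corner_ne_zero_iff_of_equivalent (hE : ∀ x, E.outDegree x ≤ 1)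
    (hF : ∀ x, F.outDegree x ≤ 1) (h₂ : C₂.IsPotential δ₂)
    (hφ : ∀ n, ∀ t ∈ LPA.component K E n, φ t ∈ LPA.component K F n)
    (ha : a ∈ LPA.component K F 0) (hb : b ∈ LPA.component K F 0) (hab : a * b = φ e)
    (hba : b * a = f) (n : ℤ) :
    (∃ t ∈ LPA.component K E n, t ≠ 0 ∧ e * t = t ∧ t * e = t) ↔
      ∃ t ∈ LPA.component K F n, t ≠ 0 ∧ f * t = t ∧ t * f = t := by
  classical
  have hmul : ∀ {s t r : LPA K F}, s ∈ LPA.component K F 0 → t ∈ LPA.component K F n →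
      r ∈ LPA.component K F 0 → s * t * r ∈ LPA.component K F n := fun hs ht hr => by
    simpa using LPA.mul_mem_component hF h₂ (LPA.mul_mem_component hF h₂ hs ht) hr
  constructor
  · rintro ⟨t, ht, h0, h1, h2⟩
    have h1' : a * b * φ t = φ t := by rw [hab, ← map_mul, h1]
    have h2' : φ t * (a * b) = φ t := by rw [hab, ← map_mul, h2]
    refine ⟨b * φ t * a, hmul hb (hφ n t ht) ha, fun h => h0 ?_, ?_, ?_⟩
    · refine φ.injective ?_
      rw [map_zero, ← h1', ← h2']
      calc a * b * (φ t * (a * b)) = a * (b * φ t * a) * b := by simp only [mul_assoc]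
        _ = 0 := by rw [h, mul_zero, zero_mul]
    · calc f * (b * φ t * a) = b * (a * b * φ t) * a := by rw [← hba]; simp only [mul_assoc]
        _ = _ := by rw [h1']
    · calc b * φ t * a * f = b * (φ t * (a * b)) * a := by rw [← hba]; simp only [mul_assoc]
        _ = _ := by rw [h2']
  · rintro ⟨t, ht, h0, h1, h2⟩
    rw [← hba] at h1 h2
    refine ⟨φ.symm (a * t * b), LPA.symm_mem_component hE hF hφ (hmul ha ht hb),
      fun h => h0 ?_, φ.injective ?_, φ.injective ?_⟩
    · have h' : a * t * b = 0 := by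
        rw [← φ.apply_symm_apply (a * t * b), h, map_zero]
      rw [← h1, ← h2]
      calc b * a * (t * (b * a)) = b * (a * t * b) * a := by simp only [mul_assoc]
        _ = 0 := by rw [h', mul_zero, zero_mul]
    · rw [map_mul, φ.apply_symm_apply, ← hab]
      calc a * b * (a * t * b) = a * (b * a * t) * b := by simp only [mul_assoc]
        _ = _ := by rw [h1]
    · rw [map_mul, φ.apply_symm_apply, ← hab]
      calc a * t * b * (a * b) = a * (t * (b * a)) * b := by simp only [mul_assoc]
        _ = _ := by rw [h2]

end Equivalent

theorem LPA.relDepth_of_gradedIso (hE : E.Connected) (hF : F.Connected)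
    (hE1 : ∀ x, E.outDegree x ≤ 1) (hF1 : ∀ x, F.outDegree x ≤ 1) (C₁ : E.Cyc) (C₂ : F.Cyc)
    (h : LPA.GradedIso K E F) :
    C₁.length = C₂.length ∧ ∃ v₀ w₀, C₁.IsOn v₀ ∧ C₂.IsOn w₀ ∧
      ∀ d, C₁.numRelDepth v₀ d = C₂.numRelDepth w₀ d := by
  obtain ⟨φ, hφ⟩ := h
  obtain ⟨δ₁, h₁⟩ := C₁.exists_isPotential hE (src_injective hE1)
  obtain ⟨δ₂, h₂⟩ := C₂.exists_isPotential hF (src_injective hF1)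
  obtain ⟨w, a, ha, b, hb, hab, hba⟩ := LPA.exists_vert_equivalent hE1 hF1 h₂ hφ C₁.base
  have hcol : ∀ n : ℤ, {x | (n : ZMod C₁.length) = δ₁ x - δ₁ C₁.base}.ncard =
      {x | (n : ZMod C₂.length) = δ₂ x - δ₂ w}.ncard := fun n => by
    rw [← LPA.finrank_column (K := K) hE1 h₁, ← LPA.finrank_column (K := K) hF1 h₂]
    exact LPA.finrank_column_eq hE1 hF1 h₂ hφ ha hb hab hba n
  have hdvd : ∀ n : ℤ, (C₁.length : ℤ) ∣ n ↔ (C₂.length : ℤ) ∣ n := fun n => by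
    rw [← LPA.exists_corner_ne_zero_iff (K := K) hE1 h₁ C₁.base,
      ← LPA.exists_corner_ne_zero_iff (K := K) hF1 h₂ w]
    exact LPA.exists_corner_ne_zero_iff_of_equivalent hE1 hF1 h₂ hφ ha hb hab hba n
  have hC : C₁.length = C₂.length := Nat.dvd_antisymm
    (Int.natCast_dvd_natCast.1 ((hdvd _).2 dvd_rfl)) (Int.natCast_dvd_natCast.1 ((hdvd _).1 dvd_rfl))
  obtain ⟨w₀, hw₀, hw₀'⟩ : ∃ w₀, C₂.IsOn w₀ ∧ δ₂ w₀ = δ₂ w := by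
    -- For a trivial cycle, the sink lies at potential `-p.length` relative to `w`. By equality of
    -- the counts, some vertex of `E` lies at `-p.length` relative to its sink; potentials relative
    -- to a sink are nonnegative, so `p` is empty. For a nontrivial cycle every potential occurs on
    -- it.
    by_cases h0 : C₂.length = 0
    · refine ⟨C₂.base, Or.inl rfl, ?_⟩
      obtain ⟨p, hp⟩ := h₂.exists_isPath_base w
      have hne : {x | ((-p.length : ℤ) : ZMod C₂.length) = δ₂ x - δ₂ w}.Nonempty :=
        ⟨C₂.base, by simp [h₂.length_eq hp]⟩
      have hpos := (Set.ncard_pos).2 hne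
      rw [← hcol] at hpos
      obtain ⟨x, hx⟩ := (Set.ncard_pos).1 hpos
      obtain ⟨q, hq⟩ := h₁.exists_isPath_base x
      have hx' : ((-p.length : ℤ) : ZMod C₁.length) = δ₁ x - δ₁ C₁.base := hx
      rw [← h₁.length_eq hq] at hx'
      have hz : ((q.length + p.length : ℕ) : ZMod C₁.length) = 0 := by
        push_cast at hx' ⊢
        rw [← hx']; ring
      rw [ZMod.natCast_eq_zero_iff, hC, h0, zero_dvd_iff] at hz
      have hp0 : p.length = 0 := by omega
      have := h₂.length_eq hp
      rw [hp0, Nat.cast_zero] at this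
      exact (sub_eq_zero.1 this.symm).symm
    · exact h₂.exists_isOn h0 _
  refine ⟨hC, C₁.base, w₀, Or.inl rfl, hw₀, fun d => ?_⟩
  have hcol' := hcol d
  rw [Int.cast_natCast, Int.cast_natCast] at hcol'
  simp only [Cyc.numRelDepth, h₁.hasRelDepth_iff (Or.inl rfl : C₁.IsOn C₁.base),
    h₂.hasRelDepth_iff hw₀, hw₀']
  -- If `d` is not reduced modulo `|C₁|`, no vertex has relative depth `d` and both counts are 0.
  by_cases hd : d % C₁.length = d
  · have hd' := hC ▸ hd
    simpa only [hd, hd', true_and] using hcol'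
  · have hd' : ¬ d % C₂.length = d := hC ▸ hd
    simp only [hd, hd', false_and]
    exact (Set.ncard_empty V).trans (Set.ncard_empty V').symm

end GradedIso
end DirectedGraph

theorem theorem3 {K : Type*} [Field K] {V A V' A' : Type*}
    [Fintype V] [Fintype A] [Fintype V'] [Fintype A']
    (E : DirectedGraph V A) (F : DirectedGraph V' A')
    (hE : E.Connected) (hF : F.Connected)
    (hE1 : ∀ x, E.outDegree x ≤ 1) (hF1 : ∀ x, F.outDegree x ≤ 1)
    (C₁ : E.Cyc) (C₂ : F.Cyc) :
    List.TFAE [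
      DirectedGraph.LPA.GradedIso K E F,
      DirectedGraph.LI.GradedIso E F,
      C₁.length = C₂.length ∧ ∃ v₀ w₀, C₁.IsOn v₀ ∧ C₂.IsOn w₀ ∧
        ∀ d : ℕ, C₁.numRelDepth v₀ d = C₂.numRelDepth w₀ d] := by
  tfae_have 1 → 3 := DirectedGraph.LPA.relDepth_of_gradedIso hE hF hE1 hF1 C₁ C₂
  tfae_have 3 → 2 := fun ⟨hC, _, _, hv, hw, hd⟩ =>
    DirectedGraph.LI.gradedIso_of_numRelDepth hE hF hE1 hF1 C₁ C₂ hC hv hw hd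
  tfae_have 2 → 1 := DirectedGraph.LPA.gradedIso_of_LI K hE1 hF1
  tfae_finish
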